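/- **Setting.** Let $1\le d\le p$ be integers. For $S\subseteq\mathbb R^p$ let $|S|_d$ be its $d$-dimensional Hausdorff measure, normalized so that a $d$-dimensional unit cube has measure $1$; write $dx$ for integration against it. Let $\Omega\subset\mathbb R^p$ be an infinite compact set with $0<|\Omega|_d<\infty$. Let $k(x,y)=f(|x-y|)$, where $f$ is completely monotone on $(0,\infty)$ (that is, $f\in C^\infty(0,\infty)$ and $(-1)^\ell f^{(\ell)}\ge0$ on $(0,\infty)$ for all $\ell\ge0$), $k(x,y)>0$ for distinct $x,y\in\Omega$, and $\int_{\Omega\times\Omega}k\,dx\,dy<\infty$. Let $r,R>0$ and $\rho_+\ge|\Omega|_d^{-1}\ge\rho_->0$. *Discrete problem.* A configuration $X_n=\{x_1,\dots,x_n\}\subset\Omega$ is *admissible* if $|x_i-x_j|\ge rn^{-1/d}$ for all $i\ne j$ and every closed ball of radius $Rn^{-1/d}$ centered at a point of $\Omega$ contains a point of $X_n$. Let $$M_n=\sup\Big\{\frac1{2n^2}\sum_{i\ne j}k(x_i,x_j):\ X_n\text{ admissible}\Big\}.$$ *Density problem.* Let $A(\Omega,\rho_+,\rho_-)$ be the set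 of $\rho\in L^\infty(\Omega)$ with $\int_\Omega\rho\,dx=1$ and $\rho_-\le\rho\le\rho_+$ a.e., and let $E[\rho]=\frac12\int_{\Omega\times\Omega}k(x,y)\rho(x)\rho(y)\,dx\,dy$. A density $\rho^\star\in A(\Omega,\rho_+,\rho_-)$ is *extremal* if it maximizes $E$ over $A(\Omega,\rho_+,\rho_-)$. *Constants.* Let $\beta_d=\pi^{d/2}/\Gamma(d/2+1)$. For a sequence $(S_j)$ of closed unit balls in $\mathbb R^d$ consider the density $\lim_{t\to\infty}(2t)^{-d}\sum_j|S_j\cap[-t,t]^d|_d$, when this limit exists. $\Delta_d$ is the supremum of these densities over sequences of balls with pairwise disjoint interiors, and $\Theta_d$ is their infimum over sequences that cover $\mathbb R^d$. *Contents.* For $X\subset\mathbb R^p$ and $\delta>0$ let $Q_d(X,\delta)$ be the supremum of $N\beta_d\delta^d$ over families of $N$ pairwise disjoint closed balls of radius $\delta$ with centers in $X$, and $C_d(X,\delta)$ the infimum of $N\beta_d\delta^d$ over covers of $X$ by $N$ closed balls of radius $\delta$ with centers in $X$. Put $Q_d(X)=\limsup_{\delta\to0^+}Q_d(X,\delta)$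 and $C_d(X)=\liminf_{\delta\to0^+}C_d(X,\delta)$. The set $\Omega$ is of *Euclidean type* if for every relatively open $U\subseteq\Omega$ with $|U|_d=|\overline U|_d$ one has $Q_d(U)=Q_d(\overline U)=|U|_d\Delta_d$ and $C_d(U)=C_d(\overline U)=|U|_d\Theta_d$. *Regular basis.* Let $P_d(X)=\lim_{\delta\to0^+}\sup\sum_i(\operatorname{diam}B_i)^d$, the supremum being over countable families of pairwise disjoint closed balls with centers in $X$ and diameters at most $\delta$, and let $h_d(X)=\lim_{\delta\to0^+}\inf\sum_i(\operatorname{diam}B_i)^d$, the infimum being over countable covers of $X$ by open balls of diameter less than $\delta$. The set $\Omega$ has a *regular basis* if its topology has a basis of sets $U$ with $h_d(\partial U)=P_d(\partial U)=0$ (boundary in $\Omega$) and $P_d(U)=h_d(U)$. **Theorem.** Suppose that $\Omega$ is a smooth $d$-dimensional embedded submanifold of $\mathbb R^p$, possibly with boundary, that has a regular basis and is of Euclidean type. Suppose that admissible configurations exist for all sufficiently large $n$, that $$\rho_+r^d\beta_d\ge2^d\Delta_d\quad\text{and}\quad\rho_-R^d\beta_d\le\Theta_d,$$ and that there is a constant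 $C_0$ with $$\frac{f(x)}{f(x+\sqrt2\,Rn^{-1/d})}\le C_0\qquad\text{for all }n\ge1\text{ and all }x\ge rn^{-1/d}.$$ Then $$\limsup_{n\to\infty}M_n\ \le\ \sup\{E[\rho]:\rho\in A(\Omega,\rho_+,\rho_-)\}.$$ If moreover there are $n$-point configurations $X_n'=\{x_1',\dots,x_n'\}\subset\Omega$, admissible for all sufficiently large $n$, such that the measures $\frac1n\sum_{j=1}^n\delta_{x_j'}$ converge weak-* (tested against continuous functions on $\Omega$) to $\rho^\star\,dx$ for some extremal $\rho^\star$, then $$\lim_{n\to\infty}M_n\ =\ \sup\{E[\rho]:\rho\in A(\Omega,\rho_+,\rho_-)\}.$$ -/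

import Mathlib

open MeasureTheory Filter Topology Set
open scoped ENNReal ContDiff

noncomputable section

namespace PointEnergy

/-- The ambient Euclidean space of dimension `p`. -/
abbrev Space (p : ℕ) : Type := EuclideanSpace ℝ (Fin p)

/-- `d`-dimensional Hausdorff measure on `Ω`, normalized so that a unit `d`-cube has measure one,
as a measure on the ambient space carried by `Ω`. -/
def surface (d : ℕ) {p : ℕ} (Ω : Set (Space p)) : Measure (Space p) :=
  (Measure.euclideanHausdorffMeasure d).restrict Ω

/-! ### Smooth submanifolds -/

/-- The coordinate plane spanned by the first `d` axes. -/
def flatModel (d p : ℕ) : Set (Space p) :=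
  {v | ∀ i : Fin p, d ≤ (i : ℕ) → v i = 0}

/-- The half of that plane on which the first coordinate is nonnegative. -/
def halfModel (d p : ℕ) : Set (Space p) :=
  {v | v ∈ flatModel d p ∧ ∀ i : Fin p, (i : ℕ) = 0 → 0 ≤ v i}

/-- `Ω` is a smooth `d`-dimensional embedded submanifold, possibly with boundary: near each of its
points a diffeomorphism of open subsets of the ambient space straightens it to a `d`-plane or to a
half `d`-plane. -/
def IsSmoothSubmanifold (d : ℕ) {p : ℕ} (Ω : Set (Space p)) : Prop :=
  ∀ x ∈ Ω, ∃ Φ : OpenPartialHomeomorph (Space p) (Space p),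
    x ∈ Φ.source ∧ ContDiffOn ℝ ∞ Φ Φ.source ∧ ContDiffOn ℝ ∞ Φ.symm Φ.target ∧
      (Φ.IsImage Ω (flatModel d p) ∨ Φ.IsImage Ω (halfModel d p))

/-! ### Packing premeasure and Hausdorff measure defined through balls

A ball of positive radius is encoded by the pair (center, radius). -/

/-- Supremum of `∑ (diam B)^d` over countable families of pairwise disjoint closed balls of diameter
at most `δ` with centers in `X`. -/
def packingPre (d : ℕ) {p : ℕ} (X : Set (Space p)) (δ : ℝ) : ℝ≥0∞ :=
  ⨆ (T : Set (Space p × ℝ)) (_ : T.Countable)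
    (_ : ∀ b ∈ T, 0 < b.2 ∧ b.1 ∈ X ∧ Metric.ediam (Metric.closedBall b.1 b.2) ≤ ENNReal.ofReal δ)
    (_ : T.PairwiseDisjoint fun b => Metric.closedBall b.1 b.2),
    ∑' b : T, Metric.ediam (Metric.closedBall b.1.1 b.1.2) ^ d

/-- The packing premeasure: the limit of `packingPre d X δ` as `δ → 0+`, which is an infimum because
`packingPre` is monotone in `δ`. -/
def packingPremeasure (d : ℕ) {p : ℕ} (X : Set (Space p)) : ℝ≥0∞ :=
  ⨅ (δ : ℝ) (_ : 0 < δ), packingPre d X δ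

/-- Infimum of `∑ (diam B)^d` over countable covers of `X` by open balls of diameter less
than `δ`. -/
def hausdorffPre (d : ℕ) {p : ℕ} (X : Set (Space p)) (δ : ℝ) : ℝ≥0∞ :=
  ⨅ (T : Set (Space p × ℝ)) (_ : T.Countable)
    (_ : ∀ b ∈ T, 0 < b.2 ∧ Metric.ediam (Metric.ball b.1 b.2) < ENNReal.ofReal δ)
    (_ : X ⊆ ⋃ b ∈ T, Metric.ball b.1 b.2),
    ∑' b : T, Metric.ediam (Metric.ball b.1.1 b.1.2) ^ d

/-- The Hausdorff outer measure built from ball covers: the limit of `hausdorffPre d X δ` as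
`δ → 0+`, which is a supremum because `hausdorffPre` is antitone in `δ`. -/
def ballHausdorff (d : ℕ) {p : ℕ} (X : Set (Space p)) : ℝ≥0∞ :=
  ⨆ (δ : ℝ) (_ : 0 < δ), hausdorffPre d X δ

/-- `Ω` has a basis of relatively open sets with negligible relative boundary on which the packing
premeasure and the Hausdorff outer measure agree. -/
def HasRegularBasis (d : ℕ) {p : ℕ} (Ω : Set (Space p)) : Prop :=
  ∃ B : Set (Set Ω), TopologicalSpace.IsTopologicalBasis B ∧
    ∀ U ∈ B,
      ballHausdorff d (Subtype.val '' frontier U) = 0 ∧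
      packingPremeasure d (Subtype.val '' frontier U) = 0 ∧
      packingPremeasure d (Subtype.val '' U) = ballHausdorff d (Subtype.val '' U)

/-! ### Packing and covering densities -/

/-- The volume of the unit ball of dimension `d`. -/
def ballVolume (d : ℕ) : ℝ :=
  Real.pi ^ ((d : ℝ) / 2) / Real.Gamma ((d : ℝ) / 2 + 1)

/-- The cube `[-t, t]^d`. -/
def cube (d : ℕ) (t : ℝ) : Set (Space d) :=
  {x | ∀ i, x i ∈ Icc (-t) t}

/-- The family of unit balls with centers `c j` has density `L`: the limit of
`∑ⱼ |Sⱼ ∩ [-t,t]^d| / (2t)^d` as `t → ∞` exists and equals `L`. -/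
def HasDensity {d : ℕ} (c : ℕ → Space d) (L : ℝ≥0∞) : Prop :=
  Tendsto (fun t : ℝ =>
      (∑' j, volume (Metric.closedBall (c j) 1 ∩ cube d t)) / ENNReal.ofReal ((2 * t) ^ d))
    atTop (𝓝 L)

/-- The upper packing density of `ℝ^d` (unit balls with disjoint interiors). -/
def packingDensity (d : ℕ) : ℝ≥0∞ :=
  sSup {L | ∃ c : ℕ → Space d,
    (∀ i j, i ≠ j → Disjoint (Metric.ball (c i) 1) (Metric.ball (c j) 1)) ∧ HasDensity c L}

/-- The lower covering density of `ℝ^d`. -/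
def coveringDensity (d : ℕ) : ℝ≥0∞ :=
  sInf {L | ∃ c : ℕ → Space d, (⋃ j, Metric.closedBall (c j) 1) = univ ∧ HasDensity c L}

/-- Supremum of `N β_d δ^d` over packings by `N` disjoint closed balls of radius `δ` with centers
in `X`. -/
def packingAt (d : ℕ) {p : ℕ} (X : Set (Space p)) (δ : ℝ) : ℝ≥0∞ :=
  ⨆ (T : Finset (Space p)) (_ : (T : Set (Space p)) ⊆ X)
    (_ : (T : Set (Space p)).PairwiseDisjoint fun c => Metric.closedBall c δ),
    (T.card : ℝ≥0∞) * ENNReal.ofReal (ballVolume d * δ ^ d)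

/-- `limsup` of `packingAt d X δ` as `δ → 0+`. -/
def packingContent (d : ℕ) {p : ℕ} (X : Set (Space p)) : ℝ≥0∞ :=
  limsup (fun δ : ℝ => packingAt d X δ) (𝓝[>] 0)

/-- Infimum of `N β_d δ^d` over covers of `X` by `N` closed balls of radius `δ` with centers
in `X`. -/
def coveringAt (d : ℕ) {p : ℕ} (X : Set (Space p)) (δ : ℝ) : ℝ≥0∞ :=
  ⨅ (T : Finset (Space p)) (_ : (T : Set (Space p)) ⊆ X)
    (_ : X ⊆ ⋃ c ∈ T, Metric.closedBall c δ),
    (T.card : ℝ≥0∞) * ENNReal.ofReal (ballVolume d * δ ^ d)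

/-- `liminf` of `coveringAt d X δ` as `δ → 0+`. -/
def coveringContent (d : ℕ) {p : ℕ} (X : Set (Space p)) : ℝ≥0∞ :=
  liminf (fun δ : ℝ => coveringAt d X δ) (𝓝[>] 0)

/-- `Ω` is of Euclidean type: for every relatively open `U` whose relative closure has the same
measure, the packing content of `U` and of its closure is `|U| Δ_d`, and the covering content of `U`
and of its closure is `|U| Θ_d`. -/
def IsEuclideanType (d : ℕ) {p : ℕ} (Ω : Set (Space p)) : Prop :=
  ∀ U : Set Ω, IsOpen U →
    surface d Ω (Subtype.val '' U) = surface d Ω (Subtype.val '' closure U) →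
      packingContent d (Subtype.val '' U) = surface d Ω (Subtype.val '' U) * packingDensity d ∧
      packingContent d (Subtype.val '' closure U)
        = surface d Ω (Subtype.val '' U) * packingDensity d ∧
      coveringContent d (Subtype.val '' U) = surface d Ω (Subtype.val '' U) * coveringDensity d ∧
      coveringContent d (Subtype.val '' closure U)
        = surface d Ω (Subtype.val '' U) * coveringDensity d

/-! ### Kernels -/

/-- Complete monotonicity on `(0, ∞)`; the values of `f` elsewhere are irrelevant. -/
def CompletelyMonotone (f : ℝ → ℝ) : Prop :=
  ContDiffOn ℝ ∞ f (Ioi 0) ∧ ∀ l : ℕ, ∀ x : ℝ, 0 < x → 0 ≤ (-1) ^ l * iteratedDeriv l f x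

/-- The kernel `k(x, y) = f(|x - y|)` is positive off the diagonal, its profile `f` is completely
monotone, and it is integrable on `Ω × Ω`. -/
structure IsKernelProfile (d : ℕ) {p : ℕ} (Ω : Set (Space p)) (f : ℝ → ℝ) : Prop where
  completelyMonotone : CompletelyMonotone f
  pos : ∀ x ∈ Ω, ∀ y ∈ Ω, x ≠ y → 0 < f (dist x y)
  integrable : Integrable (fun z : Space p × Space p => f (dist z.1 z.2))
    ((surface d Ω).prod (surface d Ω))

/-! ### The discrete problem -/

/-- The length scale `a n^{-1/d}`. -/
def scale (d : ℕ) (a : ℝ) (n : ℕ) : ℝ := a * (n : ℝ) ^ (-(1 : ℝ) / d)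

/-- Admissible `n`-point configurations: separation at least `r n^{-1/d}`, and every closed ball of
radius `R n^{-1/d}` centered on `Ω` contains a point of the configuration. -/
structure Admissible (d : ℕ) {p : ℕ} (Ω : Set (Space p)) (r R : ℝ) (n : ℕ)
    (X : Fin n → Space p) : Prop where
  mem : ∀ i, X i ∈ Ω
  separated : ∀ i j, i ≠ j → scale d r n ≤ dist (X i) (X j)
  covers : ∀ y ∈ Ω, ∃ i, X i ∈ Metric.closedBall y (scale d R n)

/-- `1 / (2 n²) ∑_{i ≠ j} f(|x_i - x_j|)`. -/
def discreteEnergy {p : ℕ} (f : ℝ → ℝ) (n : ℕ) (X : Fin n → Space p) : ℝ :=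
  1 / (2 * (n : ℝ) ^ 2) *
    ∑ q ∈ (Finset.univ : Finset (Fin n)).offDiag, f (dist (X q.1) (X q.2))

/-- The optimal value of the discrete problem with `n` points. -/
def discreteValue (d : ℕ) {p : ℕ} (Ω : Set (Space p)) (r R : ℝ) (f : ℝ → ℝ) (n : ℕ) : EReal :=
  ⨆ (X : Fin n → Space p) (_ : Admissible d Ω r R n X), (discreteEnergy f n X : EReal)

/-! ### The density problem -/

/-- The admissible densities `A(Ω, ρ₊, ρ₋)`. -/
def admissibleDensities (d : ℕ) {p : ℕ} (Ω : Set (Space p)) (ρp ρm : ℝ) : Set (Space p → ℝ) :=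
  {ρ | MemLp ρ ⊤ (surface d Ω) ∧ ∫ x, ρ x ∂(surface d Ω) = 1 ∧
    ∀ᵐ x ∂(surface d Ω), ρm ≤ ρ x ∧ ρ x ≤ ρp}

/-- The energy `E[ρ]` of a density. -/
def densityEnergy (d : ℕ) {p : ℕ} (Ω : Set (Space p)) (f : ℝ → ℝ) (ρ : Space p → ℝ) : ℝ :=
  1 / 2 * ∫ z : Space p × Space p, f (dist z.1 z.2) * ρ z.1 * ρ z.2
    ∂((surface d Ω).prod (surface d Ω))

/-- The supremum of `E` over the admissible densities. -/
def densityValue (d : ℕ) {p : ℕ} (Ω : Set (Space p)) (f : ℝ → ℝ) (ρp ρm : ℝ) : EReal :=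
  ⨆ ρ ∈ admissibleDensities d Ω ρp ρm, (densityEnergy d Ω f ρ : EReal)

/-- `ρ` attains the supremum of `E` over the admissible densities. -/
def IsExtremal (d : ℕ) {p : ℕ} (Ω : Set (Space p)) (f : ℝ → ℝ) (ρp ρm : ℝ)
    (ρ : Space p → ℝ) : Prop :=
  ρ ∈ admissibleDensities d Ω ρp ρm ∧
    ∀ σ ∈ admissibleDensities d Ω ρp ρm, densityEnergy d Ω f σ ≤ densityEnergy d Ω f ρ

/-! ### Empirical measures -/

/-- The empirical measure `(1/n) ∑ δ_{x_i}`. -/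
def empirical {p : ℕ} (n : ℕ) (X : Fin n → Space p) : Measure (Space p) :=
  (n : ℝ≥0∞)⁻¹ • ∑ i, Measure.dirac (X i)

/-- Weak-* convergence of measures carried by `Ω`: convergence of the integrals of every continuous
function on `Ω`. -/
def WeakStarTendsto {p : ℕ} (Ω : Set (Space p)) (ν : ℕ → Measure (Space p))
    (ν' : Measure (Space p)) : Prop :=
  ∀ φ : Space p → ℝ, ContinuousOn φ Ω →
    Tendsto (fun n => ∫ x, φ x ∂(ν n)) atTop (𝓝 (∫ x, φ x ∂ν'))

end PointEnergy

end

open PointEnergy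

noncomputable section

namespace PointEnergy

/-! The theorem is a compactness statement: weak limits of empirical measures of admissible
configurations are admissible densities, and the energy is continuous along such limits.

Let `ν` be a limit and `U` an open set with null frontier. Separation turns the points in `U` into
centers of disjoint balls, so their number is bounded by the packing content `|U| Δ_d`; the covering
property turns them into a cover of `U` up to a thin collar of the frontier, so their number is
bounded below through `|U| Θ_d`. The conditions on `ρp` and `ρm` are what these two counts need to
give `ρm |U| ≤ ν(closure U)` and `ν(U) ≤ ρp |U|`, whence `ν` has a density in `admissibleDensities`
(`limit_measure_open_le`, `le_limit_measure_closure`, `exists_density_of_tendsto`).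

For the energy, the kernel is truncated near the diagonal. The truncated kernel is bounded and
continuous, so its double integrals converge. The discarded part is small uniformly in the
configuration: by the ratio condition each short-range interaction is at most a constant times the
average of the kernel over a product of small balls around the two points. These products are
disjoint, and a smooth compact `Ω` gives each ball mass at least a constant over `n`, so the
short-range sum is dominated by the integral of `k` near the diagonal (`exists_near_sum_le`,
`tendsto_discreteEnergy`).

Near-maximizing configurations then give the upper bound. Configurations converging to an extremal
density give the matching lower bound. -/

/-! ### Lower regularity of smooth submanifolds -/

/-- The isometric inclusion of the first `d` coordinates, translated by `z`. -/
def coordInclusion {d k : ℕ} (z : Space (d + k)) (w : Space d) : Space (d + k) :=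
  z + WithLp.toLp 2 (Fin.addCases (fun i => w i) fun _ => 0)

lemma isometry_coordInclusion {d k : ℕ} (z : Space (d + k)) :
    Isometry (coordInclusion z : Space d → Space (d + k)) := by
  refine Isometry.of_dist_eq fun v w => ?_
  rw [coordInclusion, coordInclusion, dist_add_left, EuclideanSpace.dist_eq, EuclideanSpace.dist_eq,
    Fin.sum_univ_add]
  simp

/-- The cube `[0, s]^d`. -/
def cornerCube (d : ℕ) (s : ℝ) : Set (Space d) := {w | ∀ i, w i ∈ Icc 0 s}

lemma volume_cornerCube (d : ℕ) (s : ℝ) :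
    volume (cornerCube d s) = ENNReal.ofReal s ^ d := by
  have h : cornerCube d s = WithLp.ofLp ⁻¹' (Set.pi univ fun _ => Icc 0 s) := by
    ext w
    simp [cornerCube, Pi.le_def, forall_and]
  rw [h, (PiLp.volume_preserving_ofLp (Fin d)).measure_preimage
    (MeasurableSet.univ_pi fun _ => measurableSet_Icc).nullMeasurableSet, volume_pi_pi]
  simp

lemma norm_le_of_mem_cornerCube {d : ℕ} {s : ℝ} {w : Space d} (hw : w ∈ cornerCube d s) :
    ‖w‖ ≤ d * s := by
  have h1 : ‖w‖ ≤ ∑ i, ‖w i‖ := by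
    have := EuclideanSpace.basisFun (Fin d) ℝ |>.sum_repr w
    calc ‖w‖ = ‖∑ i, w i • EuclideanSpace.basisFun (Fin d) ℝ i‖ := by
          conv_lhs => rw [← this]
          simp
      _ ≤ ∑ i, ‖w i • EuclideanSpace.basisFun (Fin d) ℝ i‖ := norm_sum_le _ _
      _ = _ := by simp [norm_smul]
  refine h1.trans ?_
  calc ∑ i, ‖w i‖ ≤ ∑ _i : Fin d, s := Finset.sum_le_sum fun i _ => by
        rw [Real.norm_eq_abs, abs_of_nonneg (hw i).1]; exact (hw i).2
    _ = d * s := by simp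

lemma coordInclusion_mem_flatModel {d k : ℕ} {z : Space (d + k)} (hz : z ∈ flatModel d (d + k))
    (w : Space d) : coordInclusion z w ∈ flatModel d (d + k) := by
  intro i
  refine Fin.addCases (fun j hj => ?_) (fun j _ => ?_) i
  · exact absurd hj (by simp)
  · have := hz (Fin.natAdd d j) (by simp)
    simp [coordInclusion, this]

lemma coordInclusion_mem_halfModel {d k : ℕ} {z : Space (d + k)} (hz : z ∈ halfModel d (d + k))
    {w : Space d} {s : ℝ} (hw : w ∈ cornerCube d s) :
    coordInclusion z w ∈ halfModel d (d + k) := by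
  refine ⟨coordInclusion_mem_flatModel hz.1 w, fun i => ?_⟩
  refine Fin.addCases (fun j hj => ?_) (fun j hj => ?_) i
  · have h1 := hz.2 (Fin.castAdd k j) hj
    have h2 := (hw j).1
    simp only [coordInclusion, PiLp.add_apply, Fin.addCases_left]
    positivity
  · have h1 := hz.2 (Fin.natAdd d j) hj
    simpa [coordInclusion] using h1

lemma euclideanHausdorffMeasure_image_le {X Y : Type*} [EMetricSpace X] [MeasurableSpace X]
    [BorelSpace X] [EMetricSpace Y] [MeasurableSpace Y] [BorelSpace Y] {K : NNReal} {g : X → Y}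
    {s : Set X} (h : LipschitzOnWith K g s) (d : ℕ) :
    (Measure.euclideanHausdorffMeasure d : Measure Y) (g '' s) ≤
      (K : ℝ≥0∞) ^ d * (Measure.euclideanHausdorffMeasure d : Measure X) s := by
  have := h.hausdorffMeasure_image_le (Nat.cast_nonneg d)
  rw [ENNReal.rpow_natCast] at this
  simp only [Measure.euclideanHausdorffMeasure_def, Measure.smul_apply, ENNReal.smul_def,
    smul_eq_mul]
  rw [mul_left_comm]
  gcongr

/-- A flat cube with corner at `Φ x` is pulled back to `Ω`. Having `Φ x` as a corner rather than as
the center keeps the cube inside the half plane at boundary points. The Lipschitz bound for `Φ.symm`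
puts the image in the ball, and the one for `Φ` bounds its measure from below. -/
lemma IsSmoothSubmanifold.exists_local_ball_measure_ge {d p : ℕ} (hd : 1 ≤ d) (hdp : d ≤ p)
    {Ω : Set (Space p)} (hΩ : IsSmoothSubmanifold d Ω) {x₀ : Space p} (hx₀ : x₀ ∈ Ω) :
    ∃ V ∈ 𝓝 x₀, ∃ c > 0, ∃ t₀ > 0, ∀ x ∈ V ∩ Ω, ∀ t, 0 < t → t ≤ t₀ →
      ENNReal.ofReal (c * t ^ d) ≤ surface d Ω (Metric.closedBall x t) := by
  obtain ⟨k, rfl⟩ := Nat.exists_eq_add_of_le hdp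
  obtain ⟨Φ, hxs, hΦ, hΦ', hmodel⟩ := hΩ x₀ hx₀
  obtain ⟨K₁', s, hs, hK₁'⟩ := ((hΦ.contDiffAt (Φ.open_source.mem_nhds hxs)).of_le
    (by simp)).exists_lipschitzOnWith
  obtain ⟨K₂', u, hu, hK₂'⟩ := ((hΦ'.contDiffAt (Φ.open_target.mem_nhds (Φ.map_source hxs))).of_le
    (by simp)).exists_lipschitzOnWith
  -- Enlarging the Lipschitz constants to at least 1 allows division by them and gives `t / K₂ ≤ t`.
  obtain ⟨K₁, hK₁0, hK₁⟩ : ∃ K₁ : NNReal, 1 ≤ K₁ ∧ LipschitzOnWith K₁ Φ s :=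
    ⟨max 1 K₁', le_max_left _ _, hK₁'.weaken (le_max_right _ _)⟩
  obtain ⟨K₂, hK₂0, hK₂⟩ : ∃ K₂ : NNReal, 1 ≤ K₂ ∧ LipschitzOnWith K₂ Φ.symm u :=
    ⟨max 1 K₂', le_max_left _ _, hK₂'.weaken (le_max_right _ _)⟩
  have hK₁1 : (1 : ℝ) ≤ K₁ := by exact_mod_cast hK₁0
  have hK₂1 : (1 : ℝ) ≤ K₂ := by exact_mod_cast hK₂0
  have hd0 : (0 : ℝ) < d := by exact_mod_cast hd
  obtain ⟨η, hη, hηs⟩ := Metric.mem_nhds_iff.1 hs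
  obtain ⟨ε, hε, hεu⟩ := Metric.mem_nhds_iff.1
    (inter_mem hu (Φ.open_target.mem_nhds (Φ.map_source hxs)))
  -- The cube has side `t / (K₂ d)` and its pullback loses at most a factor `K₁ ^ d` of measure.
  -- Since `1/2 + 1/3 < 1`, everything stays in the balls where the Lipschitz bounds hold.
  refine ⟨Metric.ball x₀ (η / 2) ∩ (Φ.source ∩ Φ ⁻¹' Metric.ball (Φ x₀) (ε / 2)),
    inter_mem (Metric.ball_mem_nhds _ (by positivity))
      (inter_mem (Φ.open_source.mem_nhds hxs)
        ((Φ.continuousAt hxs).preimage_mem_nhds (Metric.ball_mem_nhds _ (by positivity)))),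
    ((K₁ * K₂ * d : ℝ)⁻¹) ^ d, by positivity, min (η / 3) (ε / 3), by positivity, ?_⟩
  rintro x ⟨⟨hxη, hxS, hxε⟩, hxΩ⟩ t ht htmin
  have htη : t ≤ η / 3 := htmin.trans (min_le_left _ _)
  have htε : t ≤ ε / 3 := htmin.trans (min_le_right _ _)
  set δ : ℝ := t / (K₂ * d) with hδ
  set A := coordInclusion (Φ x) '' cornerCube d δ with hA
  have hAdist : ∀ a ∈ A, dist a (Φ x) ≤ t / K₂ := by
    rintro _ ⟨w, hw, rfl⟩
    have h0 : coordInclusion (Φ x) (0 : Space d) = Φ x := by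
      ext i
      refine Fin.addCases (fun j => ?_) (fun j => ?_) i <;> simp [coordInclusion]
    calc dist (coordInclusion (Φ x) w) (Φ x)
        = dist (coordInclusion (Φ x) w) (coordInclusion (Φ x) 0) := by rw [h0]
      _ = ‖w‖ := by rw [(isometry_coordInclusion _).dist_eq, dist_zero_right]
      _ ≤ d * δ := norm_le_of_mem_cornerCube hw
      _ = t / K₂ := by rw [hδ]; field_simp
  have hAball : A ⊆ Metric.ball (Φ x₀) ε := fun a ha => by
    have h1 := hAdist a ha
    have h2 : t / K₂ ≤ t := div_le_self ht.le hK₂1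
    have h3 : dist (Φ x) (Φ x₀) < ε / 2 := hxε
    rw [Metric.mem_ball]
    linarith [dist_triangle a (Φ x) (Φ x₀)]
  have hAtarget : A ⊆ Φ.target := fun a ha => (hεu (hAball ha)).2
  have hΦxu : Φ x ∈ u := (hεu (by
    have h3 : dist (Φ x) (Φ x₀) < ε / 2 := hxε
    rw [Metric.mem_ball]; linarith)).1
  have hAΩ : Φ.symm '' A ⊆ Ω := by
    rintro _ ⟨a, ha, rfl⟩
    rcases hmodel with hm | hm
    · rw [← hm (Φ.map_target (hAtarget ha)), Φ.right_inv (hAtarget ha)]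
      obtain ⟨w, hw, rfl⟩ := ha
      exact coordInclusion_mem_flatModel ((hm hxS).2 hxΩ) w
    · rw [← hm (Φ.map_target (hAtarget ha)), Φ.right_inv (hAtarget ha)]
      obtain ⟨w, hw, rfl⟩ := ha
      exact coordInclusion_mem_halfModel ((hm hxS).2 hxΩ) hw
  have hAx : Φ.symm '' A ⊆ Metric.closedBall x t := by
    rintro _ ⟨a, ha, rfl⟩
    have h1 := hK₂.dist_le_mul a (hεu (hAball ha)).1 (Φ x) hΦxu
    rw [Φ.left_inv hxS] at h1
    have hK₂pos : (0 : ℝ) < K₂ := by linarith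
    calc dist (Φ.symm a) x ≤ K₂ * dist a (Φ x) := h1
      _ ≤ K₂ * (t / K₂) := by gcongr; exact hAdist a ha
      _ = t := by field_simp
  have hAs : Φ.symm '' A ⊆ s := fun y hy => hηs (by
    have h1 : dist y x ≤ t := hAx hy
    have h2 : dist x x₀ < η / 2 := hxη
    rw [Metric.mem_ball]
    linarith [dist_triangle y x x₀])
  have himg : Φ '' (Φ.symm '' A) = A := by
    rw [image_image]
    exact (image_congr fun a ha => Φ.right_inv (hAtarget ha)).trans (image_id' _)
  have hvol : (Measure.euclideanHausdorffMeasure d : Measure (Space (d + k))) A =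
      ENNReal.ofReal δ ^ d := by
    rw [hA, (isometry_coordInclusion _).euclideanHausdorffMeasure_image,
      EuclideanSpace.euclideanHausdorffMeasure_eq_volume, volume_cornerCube]
  have hle := euclideanHausdorffMeasure_image_le (hK₁.mono hAs) d
  rw [himg, hvol] at hle
  have hsurf : (Measure.euclideanHausdorffMeasure d : Measure (Space (d + k))) (Φ.symm '' A) ≤
      surface d Ω (Metric.closedBall x t) := by
    rw [surface, Measure.restrict_apply Metric.isClosed_closedBall.measurableSet]
    exact measure_mono (subset_inter hAx hAΩ)
  have hK₁pos : (0 : ℝ) < K₁ := by linarith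
  calc ENNReal.ofReal ((K₁ * K₂ * d : ℝ)⁻¹ ^ d * t ^ d)
      = ENNReal.ofReal ((K₁ : ℝ)⁻¹ ^ d) * ENNReal.ofReal δ ^ d := by
        rw [← ENNReal.ofReal_pow (by positivity), ← ENNReal.ofReal_mul (by positivity),
          ← mul_pow, ← mul_pow]
        congr 2
        rw [hδ]; field_simp
    _ ≤ ENNReal.ofReal ((K₁ : ℝ)⁻¹ ^ d) * ((K₁ : ℝ≥0∞) ^ d *
        (Measure.euclideanHausdorffMeasure d : Measure (Space (d + k))) (Φ.symm '' A)) := by gcongr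
    _ = (Measure.euclideanHausdorffMeasure d : Measure (Space (d + k))) (Φ.symm '' A) := by
        rw [← mul_assoc, ← ENNReal.ofReal_coe_nnreal, ← ENNReal.ofReal_pow (by positivity),
          ← ENNReal.ofReal_mul (by positivity), ← mul_pow, inv_mul_cancel₀ hK₁pos.ne']
        simp
    _ ≤ _ := hsurf

/-- A compact smooth submanifold is lower Ahlfors regular. -/
lemma IsSmoothSubmanifold.exists_ball_measure_ge {d p : ℕ} (hd : 1 ≤ d) (hdp : d ≤ p)
    {Ω : Set (Space p)} (hΩ : IsSmoothSubmanifold d Ω) (hc : IsCompact Ω) :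
    ∃ c > 0, ∃ t₀ > 0, ∀ x ∈ Ω, ∀ t, 0 < t → t ≤ t₀ →
      ENNReal.ofReal (c * t ^ d) ≤ surface d Ω (Metric.closedBall x t) := by
  refine hc.induction_on (p := fun S => ∃ c > 0, ∃ t₀ > 0, ∀ x ∈ S, ∀ t, 0 < t → t ≤ t₀ →
      ENNReal.ofReal (c * t ^ d) ≤ surface d Ω (Metric.closedBall x t)) ?_ ?_ ?_ ?_
  · exact ⟨1, one_pos, 1, one_pos, by simp⟩
  · rintro S T hST ⟨c, hc, t₀, ht₀, h⟩
    exact ⟨c, hc, t₀, ht₀, fun x hx => h x (hST hx)⟩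
  · rintro S T ⟨c, hc, t₀, ht₀, h⟩ ⟨c', hc', t₀', ht₀', h'⟩
    refine ⟨min c c', lt_min hc hc', min t₀ t₀', lt_min ht₀ ht₀', ?_⟩
    rintro x (hx | hx) t ht htt
    · refine le_trans (ENNReal.ofReal_le_ofReal ?_) (h x hx t ht (htt.trans (min_le_left _ _)))
      gcongr
      exact min_le_left _ _
    · refine le_trans (ENNReal.ofReal_le_ofReal ?_) (h' x hx t ht (htt.trans (min_le_right _ _)))
      gcongr
      exact min_le_right _ _
  · intro x hx
    obtain ⟨V, hV, c, hc, t₀, ht₀, h⟩ := hΩ.exists_local_ball_measure_ge hd hdp hx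
    exact ⟨V ∩ Ω, (inter_mem_inf hV (mem_principal_self Ω)), c, hc, t₀, ht₀, h⟩

/-! ### Counting points of admissible configurations -/

lemma ballVolume_pos (d : ℕ) : 0 < ballVolume d :=
  div_pos (Real.rpow_pos_of_pos Real.pi_pos _) (Real.Gamma_pos_of_pos (by positivity))

lemma scale_pos {d n : ℕ} {a : ℝ} (ha : 0 < a) (hn : 1 ≤ n) : 0 < scale d a n :=
  mul_pos ha (Real.rpow_pos_of_pos (by exact_mod_cast hn) _)

lemma scale_pow {d n : ℕ} (hd : 1 ≤ d) (a : ℝ) : scale d a n ^ d = a ^ d / n := by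
  rw [scale, mul_pow, ← Real.rpow_natCast ((n : ℝ) ^ _), ← Real.rpow_mul (Nat.cast_nonneg n),
    div_mul_cancel₀ _ (by positivity), Real.rpow_neg_one, div_eq_mul_inv]

lemma scale_mul (d n : ℕ) (b a : ℝ) : scale d (b * a) n = b * scale d a n := by
  rw [scale, scale, mul_assoc]

lemma scale_mono {d n : ℕ} {a b : ℝ} (h : a ≤ b) : scale d a n ≤ scale d b n := by
  rw [scale, scale]
  gcongr

lemma tendsto_scale {d : ℕ} (hd : 1 ≤ d) (a : ℝ) :
    Tendsto (fun n => scale d a n) atTop (𝓝 0) := by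
  have h : (0 : ℝ) < 1 / d := by positivity
  have := ((tendsto_rpow_neg_atTop h).comp tendsto_natCast_atTop_atTop).const_mul a
  simpa [scale, Function.comp_def, neg_div] using this

lemma tendsto_scale_nhdsGT {d : ℕ} (hd : 1 ≤ d) {a : ℝ} (ha : 0 < a) :
    Tendsto (fun n => scale d a n) atTop (𝓝[>] 0) :=
  tendsto_nhdsWithin_iff.2 ⟨tendsto_scale hd a,
    (eventually_ge_atTop 1).mono fun _ hn => scale_pos ha hn⟩

open scoped Classical in
lemma empirical_apply {p n : ℕ} (X : Fin n → Space p) {U : Set (Space p)} (hU : MeasurableSet U) :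
    empirical n X U =
      (n : ℝ≥0∞)⁻¹ * ((Finset.univ.filter fun i => X i ∈ U).card : ℝ≥0∞) := by
  simp [empirical, Measure.dirac_apply' _ hU, Set.indicator_apply, Finset.sum_boole]

lemma Admissible.injective {d p n : ℕ} {Ω : Set (Space p)} {r R : ℝ} {X : Fin n → Space p}
    (hX : Admissible d Ω r R n X) (hr : 0 < r) (hn : 1 ≤ n) : Function.Injective X := by
  intro i j hij
  by_contra h
  have := hX.separated i j h
  rw [hij, dist_self] at this
  exact (scale_pos hr hn).not_ge this

/-- Closed balls of half the separation may touch; the factor `θ < 1` makes them disjoint. -/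
lemma Admissible.empirical_mul_le_packingAt {d p n : ℕ} (hd : 1 ≤ d) {Ω : Set (Space p)} {r R : ℝ}
    {X : Fin n → Space p} (hX : Admissible d Ω r R n X) (hr : 0 < r) (hn : 1 ≤ n)
    {θ : ℝ} (hθ : θ < 1) {U : Set (Space p)} (hU : MeasurableSet U) :
    empirical n X U * ENNReal.ofReal (ballVolume d * (θ * (r / 2)) ^ d) ≤
      packingAt d (Ω ∩ U) (scale d (θ * (r / 2)) n) := by
  classical
  set T := (Finset.univ.filter fun i => X i ∈ U).image X with hT
  have hcard : T.card = (Finset.univ.filter fun i => X i ∈ U).card :=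
    Finset.card_image_of_injective _ (hX.injective hr hn)
  have hsub : (T : Set (Space p)) ⊆ Ω ∩ U := by
    intro x hx
    simp only [hT, Finset.coe_image, Finset.coe_filter, Finset.mem_univ, true_and] at hx
    obtain ⟨i, hi, rfl⟩ := hx
    exact ⟨hX.mem i, hi⟩
  have hdisj : (T : Set (Space p)).PairwiseDisjoint
      fun c => Metric.closedBall c (scale d (θ * (r / 2)) n) := by
    intro x hx y hy hxy
    simp only [hT, Finset.coe_image, Finset.coe_filter, Finset.mem_univ, true_and] at hx hy
    obtain ⟨i, -, rfl⟩ := hx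
    obtain ⟨j, -, rfl⟩ := hy
    refine Metric.closedBall_disjoint_closedBall ?_
    have hij : i ≠ j := fun h => hxy (by rw [h])
    refine lt_of_lt_of_le ?_ (hX.separated i j hij)
    have h0 := scale_pos (d := d) hr hn
    rw [show θ * (r / 2) = (θ / 2) * r by ring, scale_mul]
    nlinarith
  refine le_trans (le_of_eq ?_) (le_iSup_of_le T (le_iSup_of_le hsub (le_iSup_of_le hdisj le_rfl)))
  rw [empirical_apply X hU, hcard, scale_pow hd, ← mul_div_assoc (ballVolume d),
    ENNReal.ofReal_div_of_pos (by positivity), ENNReal.ofReal_natCast, ENNReal.div_eq_inv_mul]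
  ring

lemma _root_.IsPreconnected.inter_frontier_nonempty_of_isOpen {α : Type*} [TopologicalSpace α]
    {s U : Set α} (hs : IsPreconnected s) (hU : IsOpen U) (h1 : (s ∩ U).Nonempty)
    (h2 : (s ∩ Uᶜ).Nonempty) : (s ∩ frontier U).Nonempty := by
  by_contra h
  rw [not_nonempty_iff_eq_empty, hU.frontier_eq] at h
  have h' : ∀ x ∈ s, x ∈ closure U → x ∈ U := fun x hx hxU => by
    by_contra hn
    exact (h ▸ (⟨hx, hxU, hn⟩ : x ∈ s ∩ (closure U \ U)) : x ∈ (∅ : Set α))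
  obtain ⟨x, hx, hxU⟩ := h2
  obtain ⟨y, -, hy, hy'⟩ := hs U (closure U)ᶜ hU isClosed_closure.isOpen_compl
    (fun x hx => (em (x ∈ closure U)).imp (h' x hx) id) h1
    ⟨x, hx, fun hc => hxU (h' x hx hc)⟩
  exact hy' (subset_closure hy)

/-- The ball about `y` is connected and meets both `U` and its complement, so it meets the frontier.
-/
lemma mem_thickening_frontier {p : ℕ} {U : Set (Space p)} {x y : Space p} {δ ε : ℝ}
    (hU : IsOpen U) (hy : y ∈ U) (hx : x ∉ U) (hxy : dist x y ≤ δ) (hδε : δ < ε) :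
    y ∈ Metric.thickening ε (frontier U) := by
  have hδ : 0 ≤ δ := dist_nonneg.trans hxy
  obtain ⟨z, hz, hzU⟩ := (convex_closedBall y δ).isPreconnected.inter_frontier_nonempty_of_isOpen hU
    ⟨y, Metric.mem_closedBall_self hδ, hy⟩ ⟨x, hxy, hx⟩
  exact Metric.mem_thickening_iff.2 ⟨z, hzU, by
    rw [dist_comm]; exact (Metric.mem_closedBall.1 hz).trans_lt hδε⟩

/-- A maximal `δ`-separated subset of `A` is a `δ`-cover, and the balls of radius `δ / 2` about its
points are disjoint. Halving the radius costs `2 ^ d`. -/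
lemma exists_finset_cover_card_mul_le_packingAt {d p : ℕ} {Ω A W : Set (Space p)}
    (hΩ : IsCompact Ω) (hAΩ : A ⊆ Ω) (hAW : A ⊆ W) {δ : ℝ} (hδ : 0 < δ) :
    ∃ S : Finset (Space p), (S : Set (Space p)) ⊆ A ∧ A ⊆ ⋃ c ∈ S, Metric.closedBall c δ ∧
      (S.card : ℝ≥0∞) * ENNReal.ofReal (ballVolume d * δ ^ d) ≤
        2 ^ d * packingAt d (Ω ∩ W) (δ / 2) := by
  classical
  lift δ to NNReal using hδ.le
  have hδ' : δ ≠ 0 := by simpa using hδ.ne'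
  obtain ⟨N, -, hN, hcov⟩ := Metric.exists_finite_isCover_of_totallyBounded
    (ε := δ / 2) (by simpa using hδ') (hΩ.totallyBounded.subset hAΩ)
  have hfin : Metric.packingNumber δ A ≠ ⊤ := by
    have h1 := Metric.packingNumber_two_mul_le_externalCoveringNumber (δ / 2) A
    rw [mul_div_cancel₀ _ (two_ne_zero)] at h1
    exact ne_top_of_le_ne_top (by simpa using hN)
      (h1.trans (Metric.IsCover.externalCoveringNumber_le_encard hcov))
  have hSfin : (Metric.maximalSeparatedSet δ A).Finite := by
    rw [← Set.encard_ne_top_iff, Metric.encard_maximalSeparatedSet hfin]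
    exact hfin
  refine ⟨hSfin.toFinset, ?_, ?_, ?_⟩
  · simpa using Metric.maximalSeparatedSet_subset
  · have := (Metric.isCover_maximalSeparatedSet hfin).subset_iUnion_closedBall
    simpa using this
  · have hsub : (hSfin.toFinset : Set (Space p)) ⊆ Ω ∩ W := by
      simpa using ⟨Metric.maximalSeparatedSet_subset.trans hAΩ,
        Metric.maximalSeparatedSet_subset.trans hAW⟩
    have hdisj : (hSfin.toFinset : Set (Space p)).PairwiseDisjoint
        fun c => Metric.closedBall c ((δ : ℝ) / 2) := by
      intro x hx y hy hxy
      simp only [Set.Finite.coe_toFinset] at hx hy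
      have : (δ : ℝ≥0∞) < edist x y := Metric.isSeparated_maximalSeparatedSet hx hy hxy
      refine Metric.closedBall_disjoint_closedBall ?_
      rw [edist_nndist] at this
      have h2 : δ < nndist x y := by exact_mod_cast this
      rw [add_halves]
      exact_mod_cast h2
    have hle : (hSfin.toFinset.card : ℝ≥0∞) * ENNReal.ofReal (ballVolume d * ((δ : ℝ) / 2) ^ d) ≤
        packingAt d (Ω ∩ W) (δ / 2) :=
      le_iSup_of_le hSfin.toFinset (le_iSup_of_le hsub (le_iSup_of_le hdisj le_rfl))
    refine le_trans (le_of_eq ?_) (mul_le_mul_right hle (2 ^ d))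
    rw [mul_left_comm]
    congr 1
    rw [show (2 : ℝ≥0∞) ^ d = ENNReal.ofReal (2 ^ d) by
      rw [ENNReal.ofReal_pow (by norm_num)]; simp, ← ENNReal.ofReal_mul (by positivity)]
    congr 1
    rw [div_pow]
    field_simp

/-- `coveringAt` requires centers in `Ω ∩ U`, so configuration points outside `U` cannot serve. What
they alone cover lies in a collar of the frontier and is covered afresh, at a cost bounded by the
packing of the collar. -/
lemma Admissible.coveringAt_le {d p n : ℕ} (hd : 1 ≤ d) {Ω : Set (Space p)} (hΩ : IsCompact Ω)
    {r R : ℝ} {X : Fin n → Space p} (hX : Admissible d Ω r R n X) (hR : 0 < R)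
    (hn : 1 ≤ n) {U : Set (Space p)} (hU : IsOpen U) {ε : ℝ} (hε : scale d R n < ε) :
    coveringAt d (Ω ∩ U) (scale d R n) ≤
      empirical n X U * ENNReal.ofReal (ballVolume d * R ^ d) +
      2 ^ d * packingAt d (Ω ∩ Metric.thickening ε (frontier U)) (scale d (R / 2) n) := by
  classical
  set δ := scale d R n with hδ
  set F := Finset.univ.filter fun i => X i ∈ U with hF
  set A := (Ω ∩ U) \ ⋃ i ∈ F, Metric.closedBall (X i) δ with hA
  have hAW : A ⊆ Metric.thickening ε (frontier U) := by
    rintro y ⟨⟨hyΩ, hyU⟩, hy⟩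
    obtain ⟨i, hi⟩ := hX.covers y hyΩ
    refine mem_thickening_frontier hU hyU (x := X i) (fun hiU => hy ?_) hi hε
    rw [mem_iUnion₂]
    exact ⟨i, by simpa [hF] using hiU, by rw [Metric.mem_closedBall, dist_comm]; exact hi⟩
  obtain ⟨S, hSA, hAS, hScard⟩ := exists_finset_cover_card_mul_le_packingAt (d := d) hΩ
    (fun y hy => hy.1.1 : A ⊆ Ω) hAW (scale_pos hR hn : 0 < δ)
  have hsub : ((F.image X ∪ S : Finset (Space p)) : Set (Space p)) ⊆ Ω ∩ U := by
    intro x hx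
    rw [Finset.coe_union, mem_union] at hx
    rcases hx with hx | hx
    · simp only [hF, Finset.coe_image, Finset.coe_filter, Finset.mem_univ, true_and] at hx
      obtain ⟨i, hi, rfl⟩ := hx
      exact ⟨hX.mem i, hi⟩
    · exact (hSA hx).1
  have hcov : Ω ∩ U ⊆ ⋃ c ∈ (F.image X ∪ S), Metric.closedBall c δ := by
    intro y hy
    by_cases h : y ∈ ⋃ i ∈ F, Metric.closedBall (X i) δ
    · obtain ⟨i, hi, hyi⟩ := mem_iUnion₂.1 h
      exact mem_iUnion₂.2 ⟨X i, Finset.mem_union_left _ (Finset.mem_image_of_mem _ hi), hyi⟩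
    · obtain ⟨c, hc, hyc⟩ := mem_iUnion₂.1 (hAS ⟨hy, h⟩)
      exact mem_iUnion₂.2 ⟨c, Finset.mem_union_right _ hc, hyc⟩
  have hcard : ((F.image X ∪ S).card : ℝ≥0∞) ≤ F.card + S.card := by
    exact_mod_cast (Finset.card_union_le _ _).trans (by gcongr; exact Finset.card_image_le)
  calc coveringAt d (Ω ∩ U) δ
      ≤ ((F.image X ∪ S).card : ℝ≥0∞) * ENNReal.ofReal (ballVolume d * δ ^ d) :=
        iInf_le_of_le _ (iInf_le_of_le hsub (iInf_le_of_le hcov le_rfl))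
    _ ≤ (F.card + S.card) * ENNReal.ofReal (ballVolume d * δ ^ d) := by gcongr
    _ = F.card * ENNReal.ofReal (ballVolume d * δ ^ d) +
        S.card * ENNReal.ofReal (ballVolume d * δ ^ d) := add_mul _ _ _
    _ ≤ _ := by
        rw [div_eq_inv_mul, scale_mul, ← div_eq_inv_mul]
        refine add_le_add (le_of_eq ?_) hScard
        rw [empirical_apply X hU.measurableSet, hδ, scale_pow hd, ← mul_div_assoc (ballVolume d),
          ENNReal.ofReal_div_of_pos (by positivity), ENNReal.ofReal_natCast, ENNReal.div_eq_inv_mul]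
        ring

/-! ### Limits of empirical measures of admissible configurations -/

lemma ennreal_limsup_add_le {ι : Type*} (L : Filter ι) (u v : ι → ℝ≥0∞) :
    limsup (u + v) L ≤ limsup u L + limsup v L := by
  refine ENNReal.le_of_forall_pos_le_add fun ε hε hlt => ?_
  have hu : limsup u L < limsup u L + (ε / 2 : NNReal) :=
    ENNReal.lt_add_right (ENNReal.add_lt_top.1 hlt).1.ne (by simpa using hε.ne')
  have hv : limsup v L < limsup v L + (ε / 2 : NNReal) :=
    ENNReal.lt_add_right (ENNReal.add_lt_top.1 hlt).2.ne (by simpa using hε.ne')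
  calc limsup (u + v) L
      ≤ (limsup u L + (ε / 2 : NNReal)) + (limsup v L + (ε / 2 : NNReal)) := by
        refine limsup_le_of_le (by isBoundedDefault) ?_
        filter_upwards [eventually_lt_of_limsup_lt hu, eventually_lt_of_limsup_lt hv] with n h1 h2
        exact add_le_add h1.le h2.le
    _ = limsup u L + limsup v L + ε := by
        rw [add_add_add_comm, ← ENNReal.coe_add, add_halves]

section Limits

lemma isFiniteMeasure_surface {d p : ℕ} {Ω : Set (Space p)} (h : surface d Ω Ω < ⊤) :
    IsFiniteMeasure (surface d Ω) := by
  refine ⟨?_⟩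
  rw [surface, Measure.restrict_apply_univ]
  rwa [surface, Measure.restrict_apply_self] at h

lemma surface_compl {d p : ℕ} {Ω : Set (Space p)} (hΩ : IsCompact Ω) : surface d Ω Ωᶜ = 0 := by
  rw [surface, Measure.restrict_apply hΩ.isClosed.measurableSet.compl]
  simp

lemma surface_inter {d p : ℕ} {Ω : Set (Space p)} (hΩ : IsCompact Ω) (U : Set (Space p)) :
    surface d Ω (Ω ∩ U) = surface d Ω U := by
  rw [inter_comm]
  exact measure_inter_conull (surface_compl hΩ)

lemma surface_image_closure {d p : ℕ} {Ω : Set (Space p)} (hΩ : IsCompact Ω) {U : Set (Space p)}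
    (hfr : surface d Ω (frontier U) = 0) :
    surface d Ω (Subtype.val '' ((Subtype.val : Ω → Space p) ⁻¹' U)) =
      surface d Ω (Subtype.val '' closure ((Subtype.val : Ω → Space p) ⁻¹' U)) := by
  refine le_antisymm (measure_mono (image_mono subset_closure)) ?_
  rw [Subtype.image_preimage_coe, surface_inter hΩ]
  calc surface d Ω (Subtype.val '' closure ((Subtype.val : Ω → Space p) ⁻¹' U))
      ≤ surface d Ω (U ∪ frontier U) := by
        refine measure_mono ?_
        rw [← closure_eq_self_union_frontier]
        rintro _ ⟨x, hx, rfl⟩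
        exact continuous_subtype_val.closure_preimage_subset U hx
    _ ≤ surface d Ω U + surface d Ω (frontier U) := measure_union_le _ _
    _ = surface d Ω U := by rw [hfr, add_zero]

/-- The relative closure adds at most the ambient frontier, so ambient open sets with null frontier
qualify as test sets, matching the portmanteau theorem. -/
lemma IsEuclideanType.contents_inter {d p : ℕ} {Ω : Set (Space p)} (h : IsEuclideanType d Ω)
    (hΩ : IsCompact Ω) {U : Set (Space p)} (hU : IsOpen U) (hfr : surface d Ω (frontier U) = 0) :
    packingContent d (Ω ∩ U) = surface d Ω U * packingDensity d ∧
      coveringContent d (Ω ∩ U) = surface d Ω U * coveringDensity d := by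
  have := h (Subtype.val ⁻¹' U) (hU.preimage continuous_subtype_val) (surface_image_closure hΩ hfr)
  rw [Subtype.image_preimage_coe, surface_inter hΩ] at this
  exact ⟨this.1, this.2.2.1⟩

variable {d p : ℕ} {Ω : Set (Space p)} {r R ρp ρm : ℝ} {L : Filter ℕ}
  {X : (n : ℕ) → Fin n → Space p} {P : ℕ → ProbabilityMeasure (Space p)}
  {ν : ProbabilityMeasure (Space p)}

lemma limsup_packingAt_scale_le (hd : 1 ≤ d) (hL : L ≤ atTop) {a : ℝ} (ha : 0 < a)
    (Y : Set (Space p)) :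
    limsup (fun n => packingAt d Y (scale d a n)) L ≤ packingContent d Y :=
  limsup_le_limsup_of_le (f := map (fun n => scale d a n) L) (u := fun δ => packingAt d Y δ)
    ((tendsto_scale_nhdsGT hd ha).mono_left hL)

lemma coveringContent_le_liminf (hd : 1 ≤ d) (hL : L ≤ atTop) {a : ℝ} (ha : 0 < a)
    (Y : Set (Space p)) :
    coveringContent d Y ≤ liminf (fun n => coveringAt d Y (scale d a n)) L :=
  liminf_le_liminf_of_le (g := map (fun n => scale d a n) L) (u := fun δ => coveringAt d Y δ)
    ((tendsto_scale_nhdsGT hd ha).mono_left hL)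

/-- Portmanteau for open sets bounds `ν U` by the limiting proportion of points in `U`, which the
packing content controls. -/
lemma limit_measure_open_le [L.NeBot] (hd : 1 ≤ d) (hΩ : IsCompact Ω) (hE : IsEuclideanType d Ω)
    (hr : 0 < r) (hρp : 0 ≤ ρp)
    (h_pack : 2 ^ d * packingDensity d ≤ ENNReal.ofReal (ρp * r ^ d * ballVolume d))
    (hL : L ≤ atTop) (hX : ∀ᶠ n in L, Admissible d Ω r R n (X n))
    (hP : ∀ᶠ n in L, (P n : Measure (Space p)) = empirical n (X n)) (hν : Tendsto P L (𝓝 ν))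
    {U : Set (Space p)} (hU : IsOpen U) (hfr : surface d Ω (frontier U) = 0) :
    (ν : Measure (Space p)) U ≤ ENNReal.ofReal ρp * surface d Ω U := by
  have hβ := ballVolume_pos d
  have key : ∀ θ : ℝ, 0 < θ → θ < 1 →
      (ν : Measure (Space p)) U * ENNReal.ofReal (ballVolume d * (θ * (r / 2)) ^ d) ≤
        surface d Ω U * packingDensity d := by
    intro θ hθ0 hθ1
    have hc : ENNReal.ofReal (ballVolume d * (θ * (r / 2)) ^ d) ≠ 0 := by
      rw [ne_eq, ENNReal.ofReal_eq_zero, not_le]; positivity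
    rw [← ENNReal.le_div_iff_mul_le (Or.inl hc) (Or.inl ENNReal.ofReal_ne_top)]
    calc (ν : Measure (Space p)) U ≤ liminf (fun n => (P n : Measure (Space p)) U) L :=
          ProbabilityMeasure.le_liminf_measure_open_of_tendsto hν hU
      _ ≤ limsup (fun n => (P n : Measure (Space p)) U) L := liminf_le_limsup
      _ ≤ limsup (fun n => (ENNReal.ofReal (ballVolume d * (θ * (r / 2)) ^ d))⁻¹ *
          packingAt d (Ω ∩ U) (scale d (θ * (r / 2)) n)) L := by
          refine limsup_le_limsup ?_
          filter_upwards [hX, hP, hL (eventually_ge_atTop 1)] with n h1 h2 h3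
          rw [h2, ← ENNReal.div_eq_inv_mul,
            ENNReal.le_div_iff_mul_le (Or.inl hc) (Or.inl ENNReal.ofReal_ne_top)]
          exact h1.empirical_mul_le_packingAt hd hr h3 hθ1 hU.measurableSet
      _ = (ENNReal.ofReal (ballVolume d * (θ * (r / 2)) ^ d))⁻¹ *
          limsup (fun n => packingAt d (Ω ∩ U) (scale d (θ * (r / 2)) n)) L :=
          ENNReal.limsup_const_mul_of_ne_top (ENNReal.inv_ne_top.2 hc)
      _ ≤ (ENNReal.ofReal (ballVolume d * (θ * (r / 2)) ^ d))⁻¹ *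
          (surface d Ω U * packingDensity d) := by
          gcongr
          rw [← (hE.contents_inter hΩ hU hfr).1]
          exact limsup_packingAt_scale_le hd hL (by positivity) _
      _ = _ := ENNReal.div_eq_inv_mul.symm
  -- The strict shrinking of the balls is removed by letting `θ` increase to 1.
  have key1 : (ν : Measure (Space p)) U * ENNReal.ofReal (ballVolume d * (1 * (r / 2)) ^ d) ≤
      surface d Ω U * packingDensity d := by
    have ht : Tendsto (fun θ : ℝ => (ν : Measure (Space p)) U *
        ENNReal.ofReal (ballVolume d * (θ * (r / 2)) ^ d)) (𝓝[<] 1)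
        (𝓝 ((ν : Measure (Space p)) U * ENNReal.ofReal (ballVolume d * (1 * (r / 2)) ^ d))) := by
      refine ENNReal.Tendsto.const_mul ?_ (Or.inr (measure_ne_top _ _))
      refine ENNReal.tendsto_ofReal ?_
      refine Tendsto.mono_left ?_ nhdsWithin_le_nhds
      exact (by fun_prop : Continuous fun θ : ℝ => ballVolume d * (θ * (r / 2)) ^ d).tendsto 1
    refine le_of_tendsto ht ?_
    filter_upwards [Ioo_mem_nhdsLT (zero_lt_one' ℝ)] with θ hθ using key θ hθ.1 hθ.2
  -- The packing radius is `r / 2`, which accounts for the `2 ^ d` in `h_pack`.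
  have h2 : (2 : ℝ≥0∞) ^ d * ENNReal.ofReal (ballVolume d * (1 * (r / 2)) ^ d) =
      ENNReal.ofReal (ballVolume d * r ^ d) := by
    rw [show (2 : ℝ≥0∞) ^ d = ENNReal.ofReal (2 ^ d) by
      rw [ENNReal.ofReal_pow (by norm_num)]; simp, ← ENNReal.ofReal_mul (by positivity)]
    congr 1
    rw [one_mul, div_pow]
    field_simp
  have hc : ENNReal.ofReal (ballVolume d * r ^ d) ≠ 0 := by
    rw [ne_eq, ENNReal.ofReal_eq_zero, not_le]; positivity
  refine (ENNReal.mul_le_mul_iff_left hc ENNReal.ofReal_ne_top).1 ?_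
  calc (ν : Measure (Space p)) U * ENNReal.ofReal (ballVolume d * r ^ d)
      = 2 ^ d * ((ν : Measure (Space p)) U *
          ENNReal.ofReal (ballVolume d * (1 * (r / 2)) ^ d)) := by rw [← h2]; ring
    _ ≤ 2 ^ d * (surface d Ω U * packingDensity d) := by gcongr
    _ = surface d Ω U * (2 ^ d * packingDensity d) := by ring
    _ ≤ surface d Ω U * ENNReal.ofReal (ρp * r ^ d * ballVolume d) := by gcongr
    _ = _ := by
      rw [show ρp * r ^ d * ballVolume d = ρp * (ballVolume d * r ^ d) by ring,
        ENNReal.ofReal_mul hρp]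
      ring

/-- Portmanteau for closed sets is combined with the covering count. The collar term vanishes as the
collar shrinks to the null frontier, provided the packing density is finite. -/
lemma le_limit_measure_closure [L.NeBot] (hd : 1 ≤ d) (hΩ : IsCompact Ω)
    (hfin : surface d Ω Ω < ⊤) (hE : IsEuclideanType d Ω)
    (hR : 0 < R) (hρm : 0 < ρm) (h_pack : packingDensity d ≠ ⊤)
    (h_cover : ENNReal.ofReal (ρm * R ^ d * ballVolume d) ≤ coveringDensity d)
    (hL : L ≤ atTop) (hX : ∀ᶠ n in L, Admissible d Ω r R n (X n))
    (hP : ∀ᶠ n in L, (P n : Measure (Space p)) = empirical n (X n)) (hν : Tendsto P L (𝓝 ν))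
    {U : Set (Space p)} (hU : IsOpen U) (hfr : surface d Ω (frontier U) = 0) :
    ENNReal.ofReal ρm * surface d Ω U ≤ (ν : Measure (Space p)) (closure U) := by
  have := isFiniteMeasure_surface hfin
  have hβ := ballVolume_pos d
  set b := ENNReal.ofReal (ballVolume d * R ^ d) with hb
  have hb0 : b ≠ 0 := by
    rw [hb, ne_eq, ENNReal.ofReal_eq_zero, not_le]; positivity
  have h2top : (2 : ℝ≥0∞) ^ d ≠ ⊤ := by simp
  have key : ∀ ε : ℝ, 0 < ε → surface d Ω (frontier (Metric.thickening ε (frontier U))) = 0 →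
      surface d Ω U * coveringDensity d ≤ (ν : Measure (Space p)) (closure U) * b +
        2 ^ d * (surface d Ω (Metric.thickening ε (frontier U)) * packingDensity d) := by
    intro ε hε hεfr
    rw [← (hE.contents_inter hΩ hU hfr).2]
    calc coveringContent d (Ω ∩ U)
        ≤ liminf (fun n => coveringAt d (Ω ∩ U) (scale d R n)) L :=
          coveringContent_le_liminf hd hL hR _
      _ ≤ limsup (fun n => coveringAt d (Ω ∩ U) (scale d R n)) L := liminf_le_limsup
      _ ≤ limsup ((fun n => b * (P n : Measure (Space p)) (closure U)) +
            fun n => 2 ^ d * packingAt d (Ω ∩ Metric.thickening ε (frontier U))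
              (scale d (R / 2) n)) L := by
          refine limsup_le_limsup ?_
          have hsc : ∀ᶠ n in L, scale d R n < ε :=
            hL ((tendsto_scale hd R).eventually_lt_const hε)
          filter_upwards [hX, hP, hL (eventually_ge_atTop 1), hsc] with n h1 h2 h3 h4
          refine (h1.coveringAt_le hd hΩ hR h3 hU h4).trans ?_
          rw [Pi.add_apply, h2, mul_comm b]
          gcongr
          exact subset_closure
      _ ≤ limsup (fun n => b * (P n : Measure (Space p)) (closure U)) L +
            limsup (fun n => 2 ^ d * packingAt d (Ω ∩ Metric.thickening ε (frontier U))
              (scale d (R / 2) n)) L := ennreal_limsup_add_le _ _ _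
      _ = b * limsup (fun n => (P n : Measure (Space p)) (closure U)) L +
            2 ^ d * limsup (fun n => packingAt d (Ω ∩ Metric.thickening ε (frontier U))
              (scale d (R / 2) n)) L := by
          rw [ENNReal.limsup_const_mul_of_ne_top ENNReal.ofReal_ne_top,
            ENNReal.limsup_const_mul_of_ne_top h2top]
      _ ≤ _ := by
          rw [mul_comm b]
          gcongr
          · exact ProbabilityMeasure.limsup_measure_closed_le_of_tendsto hν isClosed_closure
          · rw [← (hE.contents_inter hΩ Metric.isOpen_thickening hεfr).1]
            exact limsup_packingAt_scale_le hd hL (by positivity) _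
  -- The widths are chosen so that the collars themselves have null frontier and their packing
  -- content is known.
  obtain ⟨ε, hε0, hε⟩ := exists_null_frontiers_thickening (surface d Ω) (frontier U)
  have hlim : Tendsto (fun j => (ν : Measure (Space p)) (closure U) * b +
      2 ^ d * (surface d Ω (Metric.thickening (ε j) (frontier U)) * packingDensity d)) atTop
      (𝓝 ((ν : Measure (Space p)) (closure U) * b + 2 ^ d * (0 * packingDensity d))) := by
    refine tendsto_const_nhds.add (ENNReal.Tendsto.const_mul
      (ENNReal.Tendsto.mul_const ?_ (Or.inr h_pack)) (Or.inr h2top))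
    rw [← hfr]
    exact (tendsto_measure_thickening_of_isClosed ⟨1, one_pos, measure_ne_top _ _⟩
      isClosed_frontier).comp (tendsto_nhdsWithin_iff.2 ⟨hε0, .of_forall fun j => (hε j).1⟩)
  have hle := ge_of_tendsto' hlim fun j => key (ε j) (hε j).1 (hε j).2
  rw [zero_mul, mul_zero, add_zero] at hle
  refine (ENNReal.mul_le_mul_iff_left hb0 ENNReal.ofReal_ne_top).1 (le_trans ?_ hle)
  calc ENNReal.ofReal ρm * surface d Ω U * b
      = surface d Ω U * ENNReal.ofReal (ρm * R ^ d * ballVolume d) := by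
        rw [show ρm * R ^ d * ballVolume d = ρm * (ballVolume d * R ^ d) by ring,
          ENNReal.ofReal_mul hρm.le]
        ring
    _ ≤ _ := by gcongr

end Limits

/-- Two finite Borel measures on a metric space that compare on open sets, up to closures, with null
frontier compare on every measurable set. -/
lemma measure_le_of_forall_isOpen_null_frontier {α : Type*} [PseudoMetricSpace α]
    [MeasurableSpace α] [BorelSpace α] {μ ν σ : Measure α} [IsFiniteMeasure μ] [IsFiniteMeasure ν]
    [IsFiniteMeasure σ]
    (h : ∀ U : Set α, IsOpen U → σ (frontier U) = 0 → μ U ≤ ν (closure U)) : μ ≤ ν := by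
  have hclosed : ∀ K : Set α, IsClosed K → μ K ≤ ν K := by
    intro K hK
    -- The closures of these thickenings lie in closed thickenings that shrink to `K`, so the
    -- closure in `h` is harmless.
    obtain ⟨ε, hε0, hε⟩ := exists_null_frontiers_thickening σ K
    have hlim : Tendsto (fun j => ν (Metric.cthickening (ε j) K)) atTop (𝓝 (ν K)) :=
      (tendsto_measure_cthickening_of_isClosed ⟨1, one_pos, measure_ne_top _ _⟩ hK).comp hε0
    refine ge_of_tendsto' hlim fun j => ?_
    calc μ K ≤ μ (Metric.thickening (ε j) K) :=
          measure_mono (Metric.self_subset_thickening (hε j).1 K)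
      _ ≤ ν (closure (Metric.thickening (ε j) K)) := h _ Metric.isOpen_thickening (hε j).2
      _ ≤ _ := measure_mono (Metric.closure_thickening_subset_cthickening _ _)
  refine Measure.le_iff.2 fun s hs => ?_
  refine le_of_forall_lt fun a ha => ?_
  obtain ⟨K, hKs, hK, haK⟩ := hs.exists_lt_isClosed_of_ne_top (measure_ne_top μ s) ha
  exact haK.trans_le ((hclosed K hK).trans (measure_mono hKs))

/-- A probability measure between two multiples of `surface d Ω` has an admissible density. -/
lemma exists_admissible_density {d p : ℕ} {Ω : Set (Space p)} (hfin : surface d Ω Ω < ⊤)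
    {ρp ρm : ℝ} (ν : Measure (Space p)) [IsProbabilityMeasure ν]
    (h1 : ENNReal.ofReal ρm • surface d Ω ≤ ν) (h2 : ν ≤ ENNReal.ofReal ρp • surface d Ω) :
    ∃ ρ ∈ admissibleDensities d Ω ρp ρm,
      ν = (surface d Ω).withDensity fun x => ENNReal.ofReal (ρ x) := by
  have := isFiniteMeasure_surface hfin
  have hac : ν ≪ surface d Ω := Measure.absolutelyContinuous_of_le_smul h2
  have := Measure.haveLebesgueDecomposition_of_sigmaFinite ν (surface d Ω)
  have hwd := Measure.withDensity_rnDeriv_eq ν (surface d Ω) hac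
  set g := ν.rnDeriv (surface d Ω) with hg
  have hgm : Measurable g := Measure.measurable_rnDeriv _ _
  have hup : g ≤ᵐ[surface d Ω] fun _ => ENNReal.ofReal ρp := by
    refine ae_le_of_forall_setLIntegral_le_of_sigmaFinite hgm fun s hs _ => ?_
    rw [← withDensity_apply _ hs, hwd, lintegral_const, Measure.restrict_apply_univ]
    simpa using h2 s
  have hlo : (fun _ => ENNReal.ofReal ρm) ≤ᵐ[surface d Ω] g := by
    refine ae_le_of_forall_setLIntegral_le_of_sigmaFinite measurable_const fun s hs _ => ?_
    rw [← withDensity_apply g hs, hwd, lintegral_const, Measure.restrict_apply_univ]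
    simpa using h1 s
  have hbd : ∀ᵐ x ∂(surface d Ω), ρm ≤ (g x).toReal ∧ (g x).toReal ≤ ρp ∧
      ENNReal.ofReal (g x).toReal = g x := by
    -- `ENNReal.ofReal` sends negative numbers to 0, so the bound on `g` yields a real one only for
    -- nonnegative `ρp`; the unit mass of `ν` forces positivity.
    have hne : (surface d Ω) ≠ 0 → 0 < ρp := by
      intro h0
      by_contra hle
      rw [ENNReal.ofReal_of_nonpos (not_lt.1 hle), zero_smul] at h2
      have : ν univ ≤ 0 := by simpa using h2 univ
      simp at this
    by_cases h0 : surface d Ω = 0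
    · rw [h0]; simp
    filter_upwards [hup, hlo] with x hx1 hx2
    have htop : g x ≠ ⊤ := ne_top_of_le_ne_top ENNReal.ofReal_ne_top hx1
    refine ⟨(ENNReal.ofReal_le_iff_le_toReal htop).1 hx2, ?_, ENNReal.ofReal_toReal htop⟩
    exact ENNReal.toReal_le_of_le_ofReal (hne h0).le hx1
  have hν : ν = (surface d Ω).withDensity fun x => ENNReal.ofReal (g x).toReal := by
    conv_lhs => rw [← hwd]
    exact withDensity_congr_ae (hbd.mono fun x hx => hx.2.2.symm)
  refine ⟨fun x => (g x).toReal, ⟨?_, ?_, hbd.mono fun x hx => ⟨hx.1, hx.2.1⟩⟩, hν⟩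
  · refine memLp_top_of_bound hgm.ennreal_toReal.aestronglyMeasurable ρp ?_
    filter_upwards [hbd] with x hx
    rw [Real.norm_eq_abs, abs_of_nonneg ENNReal.toReal_nonneg]
    exact hx.2.1
  · rw [integral_toReal hgm.aemeasurable (hup.mono fun x hx => hx.trans_lt ENNReal.ofReal_lt_top)]
    rw [← setLIntegral_univ, ← withDensity_apply _ MeasurableSet.univ, hwd]
    simp

lemma exists_density_of_tendsto {d p : ℕ} {Ω : Set (Space p)} {r R ρp ρm : ℝ} {L : Filter ℕ}
    {X : (n : ℕ) → Fin n → Space p} {P : ℕ → ProbabilityMeasure (Space p)}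
    {ν : ProbabilityMeasure (Space p)} [L.NeBot] (hd : 1 ≤ d) (hΩ : IsCompact Ω)
    (hfin : surface d Ω Ω < ⊤) (hE : IsEuclideanType d Ω)
    (hr : 0 < r) (hR : 0 < R) (hρp : 0 ≤ ρp) (hρm : 0 < ρm)
    (h_pack : 2 ^ d * packingDensity d ≤ ENNReal.ofReal (ρp * r ^ d * ballVolume d))
    (h_cover : ENNReal.ofReal (ρm * R ^ d * ballVolume d) ≤ coveringDensity d)
    (hL : L ≤ atTop) (hX : ∀ᶠ n in L, Admissible d Ω r R n (X n))
    (hP : ∀ᶠ n in L, (P n : Measure (Space p)) = empirical n (X n)) (hν : Tendsto P L (𝓝 ν)) :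
    ∃ ρ ∈ admissibleDensities d Ω ρp ρm,
      (ν : Measure (Space p)) = (surface d Ω).withDensity fun x => ENNReal.ofReal (ρ x) := by
  have := isFiniteMeasure_surface hfin
  -- Finiteness comes from `h_pack`, whose right side is the image of a real number.
  have hΔ : packingDensity d ≠ ⊤ := by
    intro h
    rw [h, ENNReal.mul_top (by positivity)] at h_pack
    exact ENNReal.ofReal_ne_top (top_le_iff.1 h_pack)
  have hfs : ∀ a : ℝ, IsFiniteMeasure (ENNReal.ofReal a • surface d Ω) := fun a =>
    Measure.smul_finite _ ENNReal.ofReal_ne_top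
  have := hfs ρp
  have := hfs ρm
  refine exists_admissible_density hfin _ ?_ ?_
  · refine measure_le_of_forall_isOpen_null_frontier (σ := surface d Ω) fun U hU hfr => ?_
    simpa using le_limit_measure_closure hd hΩ hfin hE hR hρm hΔ h_cover hL hX hP hν hU hfr
  · refine measure_le_of_forall_isOpen_null_frontier (σ := surface d Ω) fun U hU hfr => ?_
    refine (limit_measure_open_le hd hΩ hE hr hρp h_pack hL hX hP hν hU hfr).trans ?_
    rw [Measure.smul_apply, smul_eq_mul]
    gcongr
    exact subset_closure

/-! ### Kernels -/

lemma CompletelyMonotone.nonneg {f : ℝ → ℝ} (hf : CompletelyMonotone f) {x : ℝ} (hx : 0 < x) :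
    0 ≤ f x := by
  simpa using hf.2 0 x hx

lemma CompletelyMonotone.antitoneOn {f : ℝ → ℝ} (hf : CompletelyMonotone f) :
    AntitoneOn f (Ioi 0) := by
  refine antitoneOn_of_deriv_nonpos (convex_Ioi 0) hf.1.continuousOn ?_ fun x hx => ?_
  · rw [interior_Ioi]
    exact hf.1.differentiableOn (by simp)
  · rw [interior_Ioi] at hx
    have := hf.2 1 x hx
    simp only [pow_one, iteratedDeriv_one, neg_mul, one_mul] at this
    linarith

/-- Positivity at one distance realized in `Ω` passes to smaller distances by monotonicity. It is
needed because `x / 0 = 0` makes the ratio condition empty where the denominator vanishes. -/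
lemma IsKernelProfile.exists_pos_near_zero {d p : ℕ} {Ω : Set (Space p)} {f : ℝ → ℝ}
    (hf : IsKernelProfile d Ω f) (hΩ : Ω.Infinite) :
    ∃ D > 0, ∀ t, 0 < t → t ≤ D → 0 < f t := by
  obtain ⟨x, hx, y, hy, hxy⟩ := hΩ.nontrivial
  refine ⟨dist x y, dist_pos.2 hxy, fun t ht htD => ?_⟩
  exact (hf.pos x hx y hy hxy).trans_le
    (hf.completelyMonotone.antitoneOn ht (dist_pos.2 hxy : (0 : ℝ) < dist x y) htD)

/-- The profile frozen at its value at `η` on `[0, η]`. -/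
def truncate (f : ℝ → ℝ) (η : ℝ) (t : ℝ) : ℝ := f (max t η)

section Truncate

variable {f : ℝ → ℝ} {η : ℝ}

lemma CompletelyMonotone.continuous_truncate (hf : CompletelyMonotone f) (hη : 0 < η) :
    Continuous (truncate f η) :=
  hf.1.continuousOn.comp_continuous (by fun_prop) fun _ => hη.trans_le (le_max_right _ _)

lemma CompletelyMonotone.truncate_nonneg (hf : CompletelyMonotone f) (hη : 0 < η) (t : ℝ) :
    0 ≤ truncate f η t :=
  hf.nonneg (hη.trans_le (le_max_right _ _))

lemma CompletelyMonotone.truncate_le (hf : CompletelyMonotone f) (hη : 0 < η) (t : ℝ) :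
    truncate f η t ≤ f η :=
  hf.antitoneOn hη (hη.trans_le (le_max_right _ _) : (0 : ℝ) < _) (le_max_right _ _)

lemma CompletelyMonotone.truncate_le_self (hf : CompletelyMonotone f) {t : ℝ} (ht : 0 < t) :
    truncate f η t ≤ f t :=
  hf.antitoneOn ht (ht.trans_le (le_max_left _ _) : (0 : ℝ) < _) (le_max_left _ _)

lemma truncate_of_le {t : ℝ} (h : η ≤ t) : truncate f η t = f t := by
  rw [truncate, max_eq_left h]

lemma truncate_zero (hη : 0 ≤ η) : truncate f η 0 = f η := by
  rw [truncate, max_eq_right hη]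

end Truncate

/-! ### Interactions near the diagonal -/

/-- The pairs of points at distance at most `η`. -/
def nearDiagonal (p : ℕ) (η : ℝ) : Set (Space p × Space p) := {z | dist z.1 z.2 ≤ η}

lemma measurableSet_nearDiagonal (p : ℕ) (η : ℝ) : MeasurableSet (nearDiagonal p η) :=
  (isClosed_le (by fun_prop) continuous_const).measurableSet

/-- The part of the double integral of the kernel carried by pairs at distance at most `η`. -/
def nearEnergy (d : ℕ) {p : ℕ} (Ω : Set (Space p)) (f : ℝ → ℝ) (η : ℝ) : ℝ≥0∞ :=
  ∫⁻ z in nearDiagonal p η, ENNReal.ofReal (f (dist z.1 z.2))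
    ∂((surface d Ω).prod (surface d Ω))

section Near

variable {d p : ℕ} {Ω : Set (Space p)} {f : ℝ → ℝ}

lemma nullSingletonClass_surface (hd : 1 ≤ d) (Ω : Set (Space p)) :
    NullSingletonClass (surface d Ω) := by
  have hd' : (0 : ℝ) < d := by exact_mod_cast hd
  have := Measure.nullSingletonClass_hausdorff (Space p) hd'
  refine ⟨fun x => le_antisymm ?_ zero_le⟩
  refine (Measure.restrict_apply_le _ _).trans ?_
  rw [Measure.euclideanHausdorffMeasure_def, Measure.smul_apply, measure_singleton, smul_zero]

lemma surface_prod_diagonal (hd : 1 ≤ d) (hfin : surface d Ω Ω < ⊤) :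
    ((surface d Ω).prod (surface d Ω)) {z | z.1 = z.2} = 0 := by
  have := isFiniteMeasure_surface hfin
  have := nullSingletonClass_surface hd Ω
  rw [Measure.measure_prod_null (isClosed_eq continuous_fst continuous_snd).measurableSet]
  refine .of_forall fun x => ?_
  have : Prod.mk x ⁻¹' {z : Space p × Space p | z.1 = z.2} = {x} := by
    ext y; simp [eq_comm]
  change surface d Ω (Prod.mk x ⁻¹' {z | z.1 = z.2}) = 0
  rw [this, measure_singleton]

/-- The value `f 0` is arbitrary, so pointwise estimates on the kernel hold off the diagonal, which
is null because points are. -/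
lemma ae_dist_pos (hd : 1 ≤ d) (hfin : surface d Ω Ω < ⊤) :
    ∀ᵐ z ∂((surface d Ω).prod (surface d Ω)), 0 < dist z.1 z.2 := by
  have h : {z : Space p × Space p | ¬ 0 < dist z.1 z.2} = {z | z.1 = z.2} := by
    ext z; simp
  rw [ae_iff, h]
  exact surface_prod_diagonal hd hfin

lemma IsKernelProfile.nearEnergy_ne_top (hf : IsKernelProfile d Ω f) (η : ℝ) :
    nearEnergy d Ω f η ≠ ⊤ :=
  ((setLIntegral_le_lintegral _ _).trans_lt hf.integrable.lintegral_lt_top).ne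

lemma nearEnergy_mono {η η' : ℝ} (h : η ≤ η') :
    nearEnergy d Ω f η ≤ nearEnergy d Ω f η' :=
  lintegral_mono_set fun _ hz => le_trans hz h

/-- The sets `nearDiagonal p η` decrease to the null diagonal, and the integral of an integrable
kernel is absolutely continuous. -/
lemma IsKernelProfile.tendsto_nearEnergy (hd : 1 ≤ d) (hfin : surface d Ω Ω < ⊤)
    (hf : IsKernelProfile d Ω f) :
    Tendsto (fun η => (nearEnergy d Ω f η).toReal) (𝓝[>] 0) (𝓝 0) := by
  have := isFiniteMeasure_surface hfin
  have hdiag : ⋂ η : ℝ, ⋂ _ : η > 0, nearDiagonal p η = {z | z.1 = z.2} := by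
    ext z
    simp only [nearDiagonal, mem_iInter, mem_ofPred_eq]
    refine ⟨fun h => dist_le_zero.1 (le_of_forall_pos_le_add fun ε hε => ?_), fun h η hη => ?_⟩
    · simpa using h ε hε
    · rw [h, dist_self]; exact hη.le
  have h1 : Tendsto (fun η => ((surface d Ω).prod (surface d Ω)) (nearDiagonal p η))
      (𝓝[>] 0) (𝓝 0) := by
    rw [← surface_prod_diagonal (Ω := Ω) hd hfin, ← hdiag]
    exact tendsto_measure_biInter_gt
      (fun η _ => (measurableSet_nearDiagonal p η).nullMeasurableSet)
      (fun i j _ hij z hz => le_trans hz hij) ⟨1, one_pos, measure_ne_top _ _⟩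
  have h2 := tendsto_setLIntegral_zero hf.integrable.lintegral_lt_top.ne h1
  exact (ENNReal.tendsto_toReal ENNReal.zero_ne_top).comp h2

/-- The pair interactions at short distance in an admissible configuration are controlled by the
double integral of the kernel near the diagonal. -/
lemma exists_near_sum_le (hd : 1 ≤ d) (hΩ_inf : Ω.Infinite) (hfin : surface d Ω Ω < ⊤)
    (hf : IsKernelProfile d Ω f) {r R : ℝ} (hr : 0 < r) (hR : 0 < R)
    (hreg : ∃ c > 0, ∃ t₀ > 0, ∀ x ∈ Ω, ∀ t, 0 < t → t ≤ t₀ →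
      ENNReal.ofReal (c * t ^ d) ≤ surface d Ω (Metric.closedBall x t))
    {C₀ : ℝ} (h_ratio : ∀ n : ℕ, 1 ≤ n → ∀ x : ℝ, scale d r n ≤ x →
      f x / f (x + √2 * scale d R n) ≤ C₀) :
    ∃ K : ℝ, 0 ≤ K ∧ ∃ η₀ > 0, ∀ η, 0 < η → η ≤ η₀ → ∀ᶠ n : ℕ in atTop,
      ∀ X : Fin n → Space p, Admissible d Ω r R n X →
        1 / (n : ℝ) ^ 2 * ∑ q ∈ (Finset.univ : Finset (Fin n)).offDiag with dist (X q.1) (X q.2) ≤ η,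
          f (dist (X q.1) (X q.2)) ≤ K * (nearEnergy d Ω f (2 * η)).toReal := by
  have := isFiniteMeasure_surface hfin
  obtain ⟨c, hc, t₀, ht₀, hreg⟩ := hreg
  obtain ⟨D, hD, hpos⟩ := hf.exists_pos_near_zero hΩ_inf
  -- The bound `r / 3` keeps the balls about configuration points disjoint. The bound `R / 2` lets
  -- distances between points of two balls exceed that of the centers by at most `scale d R n`,
  -- within the range of the ratio condition.
  set a := min (r / 3) (R / 2) with ha
  have ha0 : 0 < a := by positivity
  set m := c * a ^ d with hm
  have hm0 : 0 < m := by positivity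
  set C := max C₀ 0 with hC
  have hC0 : 0 ≤ C := le_max_right _ _
  -- Each ball has mass at least `m / n`. With `η ≤ D / 2` the shifted argument `t + √2 * scale d R
  -- n` stays below `2 * η ≤ D`, where `f` is positive.
  refine ⟨C / m ^ 2, by positivity, D / 2, by positivity, fun η hη hηD => ?_⟩
  have hs1 : ∀ᶠ n : ℕ in atTop, √2 * scale d R n < η := by
    have := (tendsto_scale hd R).const_mul √2
    rw [mul_zero] at this
    exact this.eventually_lt_const hη
  filter_upwards [hs1, (tendsto_scale hd a).eventually_lt_const ht₀, eventually_ge_atTop 1]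
    with n hn1 hn2 hn X hX
  have hn0 : (0 : ℝ) < n := by exact_mod_cast hn
  set S := (Finset.univ : Finset (Fin n)).offDiag.filter
    (fun q => dist (X q.1) (X q.2) ≤ η) with hS
  set B : Fin n → Set (Space p) := fun i => Metric.closedBall (X i) (scale d a n) with hB
  have hrs : 0 < scale d r n := scale_pos hr hn
  have hRs : 0 < scale d R n := scale_pos hR hn
  have har : scale d a n ≤ scale d r n / 3 := by
    rw [div_eq_inv_mul, ← scale_mul, ← div_eq_inv_mul]
    exact scale_mono (min_le_left _ _)
  have haR : scale d a n ≤ scale d R n / 2 := by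
    rw [div_eq_inv_mul, ← scale_mul, ← div_eq_inv_mul]
    exact scale_mono (min_le_right _ _)
  have hBdisj : ∀ i j, i ≠ j → Disjoint (B i) (B j) := fun i j hij => by
    refine Metric.closedBall_disjoint_closedBall ?_
    have := hX.separated i j hij
    linarith
  have hBm : ∀ i, ENNReal.ofReal (m / n) ≤ surface d Ω (B i) := fun i => by
    refine le_trans (le_of_eq ?_) (hreg (X i) (hX.mem i) _ (scale_pos ha0 hn) hn2.le)
    rw [scale_pow hd, hm, mul_div_assoc]
  have hsqrt : (1 : ℝ) ≤ √2 := Real.one_le_sqrt.2 (by norm_num)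
  have hpair : ∀ q ∈ S, ENNReal.ofReal (f (dist (X q.1) (X q.2))) * ENNReal.ofReal ((m / n) ^ 2) ≤
      ENNReal.ofReal C * ∫⁻ z in B q.1 ×ˢ B q.2, ENNReal.ofReal (f (dist z.1 z.2))
        ∂((surface d Ω).prod (surface d Ω)) := by
    intro q hq
    rw [hS, Finset.mem_filter, Finset.mem_offDiag] at hq
    obtain ⟨⟨-, -, hne⟩, hqη⟩ := hq
    have hsep := hX.separated _ _ hne
    set t := dist (X q.1) (X q.2) with ht
    have hratio := h_ratio n hn t hsep
    have hposf : 0 < f (t + √2 * scale d R n) := hpos _ (by positivity) (by linarith)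
    have hft : f t ≤ C * f (t + √2 * scale d R n) := by
      rw [div_le_iff₀ hposf] at hratio
      exact hratio.trans (by gcongr; exact le_max_left _ _)
    have hptw : ∀ z ∈ B q.1 ×ˢ B q.2, ENNReal.ofReal (f t) ≤
        ENNReal.ofReal C * ENNReal.ofReal (f (dist z.1 z.2)) := by
      rintro z ⟨hz1, hz2⟩
      have hz1' : dist z.1 (X q.1) ≤ scale d a n := hz1
      have hz2' : dist z.2 (X q.2) ≤ scale d a n := hz2
      have hz0 : 0 < dist z.1 z.2 := dist_pos.2 fun h =>
        (hBdisj _ _ hne).le_bot (⟨hz1, h ▸ hz2⟩ : z.1 ∈ B q.1 ∩ B q.2)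
      have hle : dist z.1 z.2 ≤ t + √2 * scale d R n := by
        have h1 := dist_triangle4 z.1 (X q.1) (X q.2) z.2
        rw [dist_comm (X q.2) z.2] at h1
        nlinarith
      rw [← ENNReal.ofReal_mul hC0]
      refine ENNReal.ofReal_le_ofReal (hft.trans ?_)
      gcongr
      exact hf.completelyMonotone.antitoneOn hz0
        (by positivity : (0 : ℝ) < t + √2 * scale d R n) hle
    calc ENNReal.ofReal (f t) * ENNReal.ofReal ((m / n) ^ 2)
        ≤ ENNReal.ofReal (f t) * (surface d Ω (B q.1) * surface d Ω (B q.2)) := by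
          rw [ENNReal.ofReal_pow (by positivity), sq]
          gcongr <;> exact hBm _
      _ = ∫⁻ _ in B q.1 ×ˢ B q.2, ENNReal.ofReal (f t)
            ∂((surface d Ω).prod (surface d Ω)) := by
          rw [setLIntegral_const, Measure.prod_prod]
      _ ≤ ∫⁻ z in B q.1 ×ˢ B q.2, ENNReal.ofReal C * ENNReal.ofReal (f (dist z.1 z.2))
            ∂((surface d Ω).prod (surface d Ω)) :=
          setLIntegral_mono' (Metric.isClosed_closedBall.measurableSet.prod
            Metric.isClosed_closedBall.measurableSet) hptw
      _ = _ := lintegral_const_mul' _ _ ENNReal.ofReal_ne_top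
  -- Replacing centers by points of the balls lengthens distances by less than `η`.
  have hsub : ⋃ q ∈ S, B q.1 ×ˢ B q.2 ⊆ nearDiagonal p (2 * η) := by
    intro z hz
    obtain ⟨q, hq, hz1, hz2⟩ := mem_iUnion₂.1 hz
    have hz1' : dist z.1 (X q.1) ≤ scale d a n := hz1
    have hz2' : dist z.2 (X q.2) ≤ scale d a n := hz2
    have hqη := (Finset.mem_filter.1 hq).2
    have h1 := dist_triangle4 z.1 (X q.1) (X q.2) z.2
    rw [dist_comm (X q.2) z.2] at h1
    change dist z.1 z.2 ≤ 2 * η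
    nlinarith
  have hdisj : (S : Set (Fin n × Fin n)).PairwiseDisjoint fun q => B q.1 ×ˢ B q.2 := by
    intro q _ q' _ hqq
    refine Set.disjoint_left.2 fun z hz hz' => hqq (Prod.ext ?_ ?_)
    · by_contra h
      exact (hBdisj _ _ h).le_bot ⟨hz.1, hz'.1⟩
    · by_contra h
      exact (hBdisj _ _ h).le_bot ⟨hz.2, hz'.2⟩
  have htotal : ENNReal.ofReal ((∑ q ∈ S, f (dist (X q.1) (X q.2))) * (m / n) ^ 2) ≤
      ENNReal.ofReal C * nearEnergy d Ω f (2 * η) := by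
    have hnn : ∀ q ∈ S, 0 ≤ f (dist (X q.1) (X q.2)) := fun q hq => by
      rw [hS, Finset.mem_filter, Finset.mem_offDiag] at hq
      exact hf.completelyMonotone.nonneg (hrs.trans_le (hX.separated _ _ hq.1.2.2))
    rw [ENNReal.ofReal_mul (Finset.sum_nonneg hnn), ENNReal.ofReal_sum_of_nonneg hnn,
      Finset.sum_mul]
    calc _ ≤ ∑ q ∈ S, ENNReal.ofReal C * ∫⁻ z in B q.1 ×ˢ B q.2, ENNReal.ofReal (f (dist z.1 z.2))
          ∂((surface d Ω).prod (surface d Ω)) := Finset.sum_le_sum hpair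
      _ = ENNReal.ofReal C * ∫⁻ z in ⋃ q ∈ S, B q.1 ×ˢ B q.2, ENNReal.ofReal (f (dist z.1 z.2))
          ∂((surface d Ω).prod (surface d Ω)) := by
          rw [lintegral_biUnion_finset hdisj fun q _ => Metric.isClosed_closedBall.measurableSet.prod
            Metric.isClosed_closedBall.measurableSet, Finset.mul_sum]
      _ ≤ _ := by
          gcongr
          exact lintegral_mono_set hsub
  rw [← ENNReal.ofReal_toReal (hf.nearEnergy_ne_top (2 * η)), ← ENNReal.ofReal_mul hC0,
    ENNReal.ofReal_le_ofReal_iff (by positivity)] at htotal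
  have h3 : 1 / (n : ℝ) ^ 2 * (∑ q ∈ S, f (dist (X q.1) (X q.2))) =
      ((∑ q ∈ S, f (dist (X q.1) (X q.2))) * (m / n) ^ 2) / m ^ 2 := by
    field_simp
  rw [h3, div_mul_eq_mul_div]
  gcongr

end Near

/-! ### Convergence of energies -/

lemma integral_empirical {p n : ℕ} (X : Fin n → Space p) (φ : Space p → ℝ) :
    ∫ x, φ x ∂(empirical n X) = (n : ℝ)⁻¹ * ∑ i, φ (X i) := by
  rw [empirical, integral_smul_measure,
    integral_finsetSum_measure fun i _ => integrable_dirac (by simp)]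
  simp

lemma isProbabilityMeasure_empirical {p n : ℕ} (hn : 1 ≤ n) (X : Fin n → Space p) :
    IsProbabilityMeasure (empirical n X) := by
  refine ⟨?_⟩
  rw [empirical_apply X MeasurableSet.univ]
  simp only [mem_univ, Finset.filter_true, Finset.card_univ, Fintype.card_fin]
  exact ENNReal.inv_mul_cancel (by positivity) (by simp)

/-- The truncated kernel as a bounded continuous function of two points. -/
def truncatedKernel {f : ℝ → ℝ} (hf : CompletelyMonotone f) (p : ℕ) {η : ℝ} (hη : 0 < η) :
    BoundedContinuousFunction (Space p × Space p) ℝ :=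
  BoundedContinuousFunction.ofNormedAddCommGroup (fun z => truncate f η (dist z.1 z.2))
    ((hf.continuous_truncate hη).comp (by fun_prop)) (f η) fun z => by
      rw [Real.norm_eq_abs, abs_of_nonneg (hf.truncate_nonneg hη _)]
      exact hf.truncate_le hη _

/-- The product of empirical measures also charges the diagonal: `n` pairs of mass `1 / n ^ 2`, each
with kernel value `f η`. -/
lemma integral_truncatedKernel_empirical {f : ℝ → ℝ} (hf : CompletelyMonotone f) {p n : ℕ}
    (hn : 1 ≤ n) {η : ℝ} (hη : 0 < η) (X : Fin n → Space p) :
    ∫ z, truncatedKernel hf p hη z ∂((empirical n X).prod (empirical n X)) =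
      1 / (n : ℝ) ^ 2 * ∑ q ∈ (Finset.univ : Finset (Fin n)).offDiag,
        truncate f η (dist (X q.1) (X q.2)) + f η / n := by
  have := isProbabilityMeasure_empirical hn X
  have hn0 : (0 : ℝ) < n := by exact_mod_cast hn
  rw [integral_prod _ ((truncatedKernel hf p hη).integrable _)]
  simp only [integral_empirical]
  have h1 : ∑ i, (n : ℝ)⁻¹ * ∑ j, truncatedKernel hf p hη (X i, X j) =
      (n : ℝ)⁻¹ * ∑ q : Fin n × Fin n, truncate f η (dist (X q.1) (X q.2)) := by
    rw [← Finset.mul_sum, Fintype.sum_prod_type]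
    rfl
  have h2 : ∑ q : Fin n × Fin n, truncate f η (dist (X q.1) (X q.2)) =
      n * f η + ∑ q ∈ (Finset.univ : Finset (Fin n)).offDiag,
        truncate f η (dist (X q.1) (X q.2)) := by
    rw [← Finset.univ_product_univ, ← Finset.diag_union_offDiag,
      Finset.sum_union (Finset.disjoint_diag_offDiag _), Finset.sum_diag]
    simp [truncate_zero hη.le]
  rw [h1, h2]
  field_simp
  ring

section Energy

variable {d p : ℕ} {Ω : Set (Space p)} {f : ℝ → ℝ}

/-- The kernel and its truncation agree beyond `η`, so the error comes from close pairs and from the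
diagonal. -/
lemma abs_discreteEnergy_sub_le (hf : CompletelyMonotone f) {r R : ℝ} (hr : 0 < r) {n : ℕ}
    (hn : 1 ≤ n) {η : ℝ} (hη : 0 < η) {X : Fin n → Space p} (hX : Admissible d Ω r R n X) :
    |discreteEnergy f n X -
        1 / 2 * ∫ z, truncatedKernel hf p hη z ∂((empirical n X).prod (empirical n X))| ≤
      1 / (n : ℝ) ^ 2 * ∑ q ∈ (Finset.univ : Finset (Fin n)).offDiag with dist (X q.1) (X q.2) ≤ η,
          f (dist (X q.1) (X q.2)) + f η / n := by
  have hn0 : (0 : ℝ) < n := by exact_mod_cast hn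
  have hpos : ∀ q ∈ (Finset.univ : Finset (Fin n)).offDiag, 0 < dist (X q.1) (X q.2) :=
    fun q hq => (scale_pos hr hn).trans_le (hX.separated _ _ (Finset.mem_offDiag.1 hq).2.2)
  have hlow : 0 ≤ ∑ q ∈ (Finset.univ : Finset (Fin n)).offDiag,
      (f (dist (X q.1) (X q.2)) - truncate f η (dist (X q.1) (X q.2))) :=
    Finset.sum_nonneg fun q hq => sub_nonneg.2 (hf.truncate_le_self (hpos q hq))
  have hup : ∑ q ∈ (Finset.univ : Finset (Fin n)).offDiag,
      (f (dist (X q.1) (X q.2)) - truncate f η (dist (X q.1) (X q.2))) ≤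
      ∑ q ∈ (Finset.univ : Finset (Fin n)).offDiag with dist (X q.1) (X q.2) ≤ η,
          f (dist (X q.1) (X q.2)) := by
    rw [Finset.sum_filter]
    refine Finset.sum_le_sum fun q _ => ?_
    split_ifs with h
    · linarith [hf.truncate_nonneg hη (dist (X q.1) (X q.2))]
    · rw [truncate_of_le (not_le.1 h).le, sub_self]
  rw [integral_truncatedKernel_empirical hf hn hη, discreteEnergy]
  rw [Finset.sum_sub_distrib] at hlow hup
  set A := ∑ q ∈ (Finset.univ : Finset (Fin n)).offDiag, f (dist (X q.1) (X q.2))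
  set T := ∑ q ∈ (Finset.univ : Finset (Fin n)).offDiag, truncate f η (dist (X q.1) (X q.2))
  set N := ∑ q ∈ (Finset.univ : Finset (Fin n)).offDiag with dist (X q.1) (X q.2) ≤ η,
    f (dist (X q.1) (X q.2))
  have hfn : 0 ≤ f η / n := div_nonneg (hf.nonneg hη) hn0.le
  have hinv : 0 ≤ 1 / (n : ℝ) ^ 2 := by positivity
  have h1 : 0 ≤ 1 / (n : ℝ) ^ 2 * (A - T) := mul_nonneg hinv hlow
  have h2 : 1 / (n : ℝ) ^ 2 * (A - T) ≤ 1 / (n : ℝ) ^ 2 * N := mul_le_mul_of_nonneg_left hup hinv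
  have h3 : 1 / (2 * (n : ℝ) ^ 2) * A - 1 / 2 * (1 / (n : ℝ) ^ 2 * T + f η / n) =
      1 / 2 * (1 / (n : ℝ) ^ 2 * (A - T)) - 1 / 2 * (f η / n) := by
    field_simp
    ring
  rw [h3, abs_le]
  constructor <;> linarith

/-- The double integral of a kernel against a measure with density. -/
lemma integral_prod_withDensity {ρ : Space p → ℝ} (hfin : surface d Ω Ω < ⊤)
    (hρ : AEMeasurable ρ (surface d Ω)) (hρ0 : ∀ᵐ x ∂(surface d Ω), 0 ≤ ρ x)
    (g : Space p × Space p → ℝ) :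
    ∫ z, g z ∂(((surface d Ω).withDensity fun x => ENNReal.ofReal (ρ x)).prod
        ((surface d Ω).withDensity fun x => ENNReal.ofReal (ρ x))) =
      ∫ z, g z * ρ z.1 * ρ z.2 ∂((surface d Ω).prod (surface d Ω)) := by
  have := isFiniteMeasure_surface hfin
  have hm : AEMeasurable (fun x => ENNReal.ofReal (ρ x)) (surface d Ω) := hρ.ennreal_ofReal
  have hm' : AEMeasurable (fun z : Space p × Space p =>
      ENNReal.ofReal (ρ z.1) * ENNReal.ofReal (ρ z.2)) ((surface d Ω).prod (surface d Ω)) :=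
    (hm.comp_quasiMeasurePreserving Measure.quasiMeasurePreserving_fst).mul
      (hm.comp_quasiMeasurePreserving Measure.quasiMeasurePreserving_snd)
  rw [prod_withDensity₀ hm hm, integral_withDensity_eq_integral_toReal_smul₀ hm'
    (.of_forall fun z => ENNReal.mul_lt_top ENNReal.ofReal_lt_top ENNReal.ofReal_lt_top)]
  refine integral_congr_ae ?_
  filter_upwards [Measure.quasiMeasurePreserving_fst.ae hρ0,
    Measure.quasiMeasurePreserving_snd.ae hρ0] with z h1 h2
  rw [ENNReal.toReal_mul, ENNReal.toReal_ofReal h1, ENNReal.toReal_ofReal h2, smul_eq_mul]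
  ring

/-- Almost everywhere, truncation removes at most the kernel on `nearDiagonal p η`, weighted by
densities bounded by `ρp`. -/
lemma abs_densityEnergy_sub_le (hd : 1 ≤ d) (hfin : surface d Ω Ω < ⊤)
    (hf : IsKernelProfile d Ω f) {ρp ρm : ℝ} (hρm : 0 ≤ ρm) {ρ : Space p → ℝ}
    (hρ : ρ ∈ admissibleDensities d Ω ρp ρm) {η : ℝ} (hη : 0 < η) :
    |densityEnergy d Ω f ρ -
        1 / 2 * ∫ z, truncatedKernel hf.completelyMonotone p hη z
          ∂(((surface d Ω).withDensity fun x => ENNReal.ofReal (ρ x)).prod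
            ((surface d Ω).withDensity fun x => ENNReal.ofReal (ρ x)))| ≤
      ρp ^ 2 * (nearEnergy d Ω f η).toReal := by
  have := isFiniteMeasure_surface hfin
  obtain ⟨hLp, -, hbd⟩ := hρ
  have hcm := hf.completelyMonotone
  have hρm' : AEMeasurable ρ (surface d Ω) := hLp.aestronglyMeasurable.aemeasurable
  rw [integral_prod_withDensity hfin hρm' (hbd.mono fun x hx => hρm.trans hx.1), densityEnergy,
    ← mul_sub]
  have hb1 := (Measure.quasiMeasurePreserving_fst (μ := surface d Ω) (ν := surface d Ω)).ae hbd
  have hb2 := (Measure.quasiMeasurePreserving_snd (μ := surface d Ω) (ν := surface d Ω)).ae hbd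
  have hρ1 : AEStronglyMeasurable (fun z : Space p × Space p => ρ z.1)
      ((surface d Ω).prod (surface d Ω)) :=
    hLp.aestronglyMeasurable.comp_quasiMeasurePreserving Measure.quasiMeasurePreserving_fst
  have hρ2 : AEStronglyMeasurable (fun z : Space p × Space p => ρ z.2)
      ((surface d Ω).prod (surface d Ω)) :=
    hLp.aestronglyMeasurable.comp_quasiMeasurePreserving Measure.quasiMeasurePreserving_snd
  have hbdd1 : ∀ᵐ z ∂((surface d Ω).prod (surface d Ω)), ‖ρ z.1‖ ≤ ρp := by
    filter_upwards [hb1] with z hz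
    rw [Real.norm_eq_abs, abs_of_nonneg (hρm.trans hz.1)]
    exact hz.2
  have hbdd2 : ∀ᵐ z ∂((surface d Ω).prod (surface d Ω)), ‖ρ z.2‖ ≤ ρp := by
    filter_upwards [hb2] with z hz
    rw [Real.norm_eq_abs, abs_of_nonneg (hρm.trans hz.1)]
    exact hz.2
  have hint : ∀ g : Space p × Space p → ℝ, Integrable g ((surface d Ω).prod (surface d Ω)) →
      Integrable (fun z => g z * ρ z.1 * ρ z.2) ((surface d Ω).prod (surface d Ω)) :=
    fun g hg => (hg.mul_bdd hρ1 hbdd1).mul_bdd hρ2 hbdd2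
  have hT := (truncatedKernel hcm p hη).integrable ((surface d Ω).prod (surface d Ω))
  rw [← integral_sub (hint _ hf.integrable) (hint _ hT)]
  have hpt : ∀ᵐ z ∂((surface d Ω).prod (surface d Ω)),
      ‖f (dist z.1 z.2) * ρ z.1 * ρ z.2 - truncatedKernel hcm p hη z * ρ z.1 * ρ z.2‖ ≤
        ρp ^ 2 * (nearDiagonal p η).indicator
          (fun z => (ENNReal.ofReal (f (dist z.1 z.2))).toReal) z := by
    filter_upwards [hb1, hb2, ae_dist_pos hd hfin] with z h1 h2 h3
    have hρ10 := hρm.trans h1.1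
    have hρ20 := hρm.trans h2.1
    have hle : 0 ≤ f (dist z.1 z.2) - truncatedKernel hcm p hη z :=
      sub_nonneg.2 (hcm.truncate_le_self h3)
    have hle' : f (dist z.1 z.2) - truncatedKernel hcm p hη z ≤ (nearDiagonal p η).indicator
        (fun z => (ENNReal.ofReal (f (dist z.1 z.2))).toReal) z := by
      by_cases hz : z ∈ nearDiagonal p η
      · rw [indicator_of_mem hz, ENNReal.toReal_ofReal (hcm.nonneg h3)]
        have : 0 ≤ truncatedKernel hcm p hη z := hcm.truncate_nonneg hη _
        linarith
      · rw [indicator_of_notMem hz]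
        have hz' : η < dist z.1 z.2 := not_le.1 hz
        have : truncatedKernel hcm p hη z = f (dist z.1 z.2) := truncate_of_le hz'.le
        rw [this, sub_self]
    rw [← sub_mul, ← sub_mul, Real.norm_eq_abs, abs_of_nonneg (by positivity)]
    have hpp : ρ z.1 * ρ z.2 ≤ ρp ^ 2 := by
      rw [sq]; exact mul_le_mul h1.2 h2.2 hρ20 (hρ10.trans h1.2)
    rw [mul_assoc, mul_comm]
    exact mul_le_mul hpp hle' hle (sq_nonneg _)
  have hIind : Integrable ((nearDiagonal p η).indicator
      (fun z : Space p × Space p => (ENNReal.ofReal (f (dist z.1 z.2))).toReal))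
      ((surface d Ω).prod (surface d Ω)) := by
    refine Integrable.indicator ?_ (measurableSet_nearDiagonal p η)
    exact integrable_toReal_of_lintegral_ne_top hf.integrable.aemeasurable.ennreal_ofReal
      hf.integrable.lintegral_lt_top.ne
  have hval : ∫ z, (nearDiagonal p η).indicator
      (fun z : Space p × Space p => (ENNReal.ofReal (f (dist z.1 z.2))).toReal) z
      ∂((surface d Ω).prod (surface d Ω)) = (nearEnergy d Ω f η).toReal := by
    rw [integral_indicator (measurableSet_nearDiagonal p η), integral_toReal
      hf.integrable.aemeasurable.ennreal_ofReal.restrict (.of_forall fun _ => ENNReal.ofReal_lt_top)]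
    rfl
  have hnorm := norm_integral_le_of_norm_le (hIind.const_mul (ρp ^ 2)) hpt
  rw [integral_const_mul, hval, Real.norm_eq_abs] at hnorm
  rw [abs_mul, abs_of_pos (by norm_num : (0 : ℝ) < 1 / 2)]
  linarith [abs_nonneg (∫ z : Space p × Space p, (f (dist z.1 z.2) * ρ z.1 * ρ z.2 -
    truncatedKernel hcm p hη z * ρ z.1 * ρ z.2) ∂((surface d Ω).prod (surface d Ω)))]

/-- Along weakly convergent admissible configurations the discrete energies converge. -/
lemma tendsto_discreteEnergy (hd : 1 ≤ d) (hΩ_inf : Ω.Infinite) (hfin : surface d Ω Ω < ⊤)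
    (hf : IsKernelProfile d Ω f) {r R : ℝ} (hr : 0 < r) (hR : 0 < R)
    (hreg : ∃ c > 0, ∃ t₀ > 0, ∀ x ∈ Ω, ∀ t, 0 < t → t ≤ t₀ →
      ENNReal.ofReal (c * t ^ d) ≤ surface d Ω (Metric.closedBall x t))
    {C₀ : ℝ} (h_ratio : ∀ n : ℕ, 1 ≤ n → ∀ x : ℝ, scale d r n ≤ x →
      f x / f (x + √2 * scale d R n) ≤ C₀)
    {ρp ρm : ℝ} (hρm : 0 ≤ ρm) {ρ : Space p → ℝ} (hρ : ρ ∈ admissibleDensities d Ω ρp ρm)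
    {L : Filter ℕ} {X : (n : ℕ) → Fin n → Space p} {P : ℕ → ProbabilityMeasure (Space p)}
    {ν : ProbabilityMeasure (Space p)}
    (hL : L ≤ atTop) (hX : ∀ᶠ n in L, Admissible d Ω r R n (X n))
    (hP : ∀ᶠ n in L, (P n : Measure (Space p)) = empirical n (X n)) (hν : Tendsto P L (𝓝 ν))
    (hνρ : (ν : Measure (Space p)) = (surface d Ω).withDensity fun x => ENNReal.ofReal (ρ x)) :
    Tendsto (fun n => discreteEnergy f n (X n)) L (𝓝 (densityEnergy d Ω f ρ)) := by
  obtain ⟨K, hK, η₀, hη₀, hnear⟩ := exists_near_sum_le hd hΩ_inf hfin hf hr hR hreg h_ratio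
  rw [Metric.tendsto_nhds]
  intro ε hε
  -- One `η`, fixed before `n`, makes the discrete and continuous truncation errors together less
  -- than `ε / 2`. The weak convergence and the diagonal term `f η / n` take `ε / 4` each.
  have h2 : Tendsto (fun η : ℝ => (K + ρp ^ 2) * (nearEnergy d Ω f (2 * η)).toReal)
      (𝓝[>] 0) (𝓝 0) := by
    have h2' : Tendsto (fun η : ℝ => 2 * η) (𝓝[>] 0) (𝓝[>] 0) := by
      refine tendsto_nhdsWithin_iff.2 ⟨?_, ?_⟩
      · refine Tendsto.mono_left ?_ nhdsWithin_le_nhds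
        simpa using (continuous_const_mul (2 : ℝ)).tendsto 0
      · filter_upwards [self_mem_nhdsWithin] with η hη
        exact mul_pos (two_pos : (0 : ℝ) < 2) hη
    simpa using ((hf.tendsto_nearEnergy hd hfin).comp h2').const_mul (K + ρp ^ 2)
  obtain ⟨η, hηε, hη, hηη₀⟩ := ((h2.eventually_lt_const (half_pos hε)).and
    (Ioc_mem_nhdsGT hη₀)).exists
  have hcm := hf.completelyMonotone
  have hprod : Tendsto (fun n => 1 / 2 * ∫ z, truncatedKernel hcm p hη z
      ∂((P n).prod (P n) : ProbabilityMeasure (Space p × Space p)).toMeasure) L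
      (𝓝 (1 / 2 * ∫ z, truncatedKernel hcm p hη z ∂(ν.prod ν).toMeasure)) := by
    refine Tendsto.const_mul _ ?_
    refine (ProbabilityMeasure.tendsto_iff_forall_integral_tendsto.1 ?_) _
    exact (ProbabilityMeasure.continuous_prod.tendsto (ν, ν)).comp (hν.prodMk_nhds hν)
  have hfn : Tendsto (fun n : ℕ => f η / (n : ℝ)) L (𝓝 0) :=
    (tendsto_const_div_atTop_nhds_zero_nat (f η)).mono_left hL
  have hmono : (nearEnergy d Ω f η).toReal ≤ (nearEnergy d Ω f (2 * η)).toReal :=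
    ENNReal.toReal_mono (hf.nearEnergy_ne_top _) (nearEnergy_mono (by linarith))
  have hE := abs_densityEnergy_sub_le hd hfin hf hρm hρ hη
  rw [← hνρ] at hE
  filter_upwards [hX, hP, hL (eventually_ge_atTop 1), hL (hnear η hη hηη₀),
    (Metric.tendsto_nhds.1 hprod) (ε / 4) (by positivity),
    hfn.eventually_lt_const (show (0 : ℝ) < ε / 4 by positivity)] with n h1 h2 h3 h4 h5 h6
  have h7 := abs_discreteEnergy_sub_le hcm hr h3 hη h1
  have h8 := h4 _ h1
  simp only [ProbabilityMeasure.toMeasure_prod, h2, Real.dist_eq] at h5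
  rw [Real.dist_eq]
  have hρ2 : ρp ^ 2 * (nearEnergy d Ω f η).toReal ≤
      ρp ^ 2 * (nearEnergy d Ω f (2 * η)).toReal := by gcongr
  rw [abs_lt] at h5 ⊢
  rw [abs_le] at hE h7
  rw [add_mul] at hηε
  constructor <;> linarith [hE.1, hE.2, h7.1, h7.2, h5.1, h5.2]

end Energy

/-- Configurations in a compact set have weakly convergent empirical measures along an
ultrafilter. -/
lemma exists_tendsto_empirical {p : ℕ} {Ω : Set (Space p)} (hΩ : IsCompact Ω) (U : Ultrafilter ℕ)
    (hU : (U : Filter ℕ) ≤ atTop) {X : (n : ℕ) → Fin n → Space p}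
    (hX : ∀ᶠ n in (U : Filter ℕ), ∀ i, X n i ∈ Ω) :
    ∃ (P : ℕ → ProbabilityMeasure (Space p)) (ν : ProbabilityMeasure (Space p)),
      (∀ᶠ n in (U : Filter ℕ), (P n : Measure (Space p)) = empirical n (X n)) ∧
        Tendsto P U (𝓝 ν) := by
  classical
  -- At `n = 0` the empirical measure has no mass, so a Dirac mass fills in.
  let P : ℕ → ProbabilityMeasure (Space p) := fun n =>
    if hn : 1 ≤ n then ⟨empirical n (X n), isProbabilityMeasure_empirical hn _⟩
    else ⟨Measure.dirac 0, inferInstance⟩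
  have hP : ∀ n, 1 ≤ n → (P n : Measure (Space p)) = empirical n (X n) := fun n hn => by
    simp [P, hn]
  let S : Set (ProbabilityMeasure (Space p)) := {μ | (μ : Measure (Space p)) Ωᶜ = 0}
  -- Prokhorov's theorem applies: measures carried by the compact set `Ω` are tight.
  have hS : IsCompact (closure S) := by
    refine isCompact_closure_of_isTightMeasureSet ?_
    refine isTightMeasureSet_iff_exists_isCompact_measure_compl_le.2 fun ε _ => ⟨Ω, hΩ, ?_⟩
    rintro _ ⟨μ, hμ, rfl⟩
    exact (le_of_eq hμ).trans zero_le
  have hmem : ∀ᶠ n in (U : Filter ℕ), P n ∈ closure S := by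
    filter_upwards [hX, hU (eventually_ge_atTop 1)] with n h1 h2
    refine subset_closure ?_
    change (P n : Measure (Space p)) Ωᶜ = 0
    rw [hP n h2, empirical_apply _ hΩ.isClosed.measurableSet.compl]
    simp [h1]
  obtain ⟨ν, -, hν⟩ := isCompact_iff_ultrafilter_le_nhds.1 hS (U.map P)
    (le_principal_iff.2 hmem)
  exact ⟨P, ν, Eventually.mono (hU (eventually_ge_atTop 1)) hP, hν⟩

end PointEnergy

end

open PointEnergy
theorem theorem4p2 (p d : ℕ) (hd : 1 ≤ d) (hdp : d ≤ p) (Ω : Set (Space p))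
    (hΩ_inf : Ω.Infinite) (hΩ_compact : IsCompact Ω)
    (hΩ_pos : 0 < surface d Ω Ω) (hΩ_fin : surface d Ω Ω < ⊤)
    (hΩ_smooth : IsSmoothSubmanifold d Ω)
    (hΩ_basis : HasRegularBasis d Ω) (hΩ_eucl : IsEuclideanType d Ω)
    (f : ℝ → ℝ) (hf : IsKernelProfile d Ω f)
    (r R ρp ρm : ℝ) (hr : 0 < r) (hR : 0 < R)
    (hρm : 0 < ρm) (hρm_le : ρm ≤ (surface d Ω Ω).toReal⁻¹)
    (hρp_ge : (surface d Ω Ω).toReal⁻¹ ≤ ρp)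
    (h_exists : ∀ᶠ n : ℕ in atTop, ∃ X : Fin n → Space p, Admissible d Ω r R n X)
    (h_pack : 2 ^ d * packingDensity d ≤ ENNReal.ofReal (ρp * r ^ d * ballVolume d))
    (h_cover : ENNReal.ofReal (ρm * R ^ d * ballVolume d) ≤ coveringDensity d)
    (C₀ : ℝ)
    (h_ratio : ∀ n : ℕ, 1 ≤ n → ∀ x : ℝ, scale d r n ≤ x →
      f x / f (x + √2 * scale d R n) ≤ C₀) :
    limsup (fun n => discreteValue d Ω r R f n) atTop ≤ densityValue d Ω f ρp ρm ∧
    ∀ (X' : (n : ℕ) → Fin n → Space p) (ρ : Space p → ℝ),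
      (∀ᶠ n in atTop, Admissible d Ω r R n (X' n)) →
      IsExtremal d Ω f ρp ρm ρ →
      WeakStarTendsto Ω (fun n => empirical n (X' n))
        ((surface d Ω).withDensity fun x => ENNReal.ofReal (ρ x)) →
      Tendsto (fun n => discreteValue d Ω r R f n) atTop (𝓝 (densityValue d Ω f ρp ρm)) := by
  have hreg := hΩ_smooth.exists_ball_measure_ge hd hdp hΩ_compact
  have hρp : 0 ≤ ρp := (hρm.le.trans hρm_le).trans hρp_ge
  have hlim : limsup (fun n => discreteValue d Ω r R f n) atTop ≤ densityValue d Ω f ρp ρm := by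
    by_contra hcon
    obtain ⟨e, hVe, helim⟩ := EReal.lt_iff_exists_real_btwn.1 (not_le.1 hcon)
    have hfreq : ∃ᶠ n in atTop, (e : EReal) < discreteValue d Ω r R f n :=
      frequently_lt_of_lt_limsup (by isBoundedDefault) helim
    -- The supremum need not be attained; a configuration with energy above `e` is enough.
    have hex : ∀ n : ℕ, ∃ X : Fin n → Space p, (e : EReal) < discreteValue d Ω r R f n →
        Admissible d Ω r R n X ∧ e < discreteEnergy f n X := by
      intro n
      by_cases h : (e : EReal) < discreteValue d Ω r R f n
      · obtain ⟨X, hX⟩ := lt_iSup_iff.1 h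
        obtain ⟨hXa, hXe⟩ := lt_iSup_iff.1 hX
        exact ⟨X, fun _ => ⟨hXa, EReal.coe_lt_coe_iff.1 hXe⟩⟩
      · exact ⟨fun _ => 0, fun h' => absurd h' h⟩
    choose X hX using hex
    have hne : (atTop ⊓ 𝓟 {n | (e : EReal) < discreteValue d Ω r R f n}).NeBot :=
      frequently_mem_iff_neBot.1 hfreq
    -- An ultrafilter concentrated on the bad indices replaces the extraction of convergent
    -- subsequences.
    set U := Ultrafilter.of (atTop ⊓ 𝓟 {n | (e : EReal) < discreteValue d Ω r R f n})
    have hU : (U : Filter ℕ) ≤ atTop := (Ultrafilter.of_le _).trans inf_le_left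
    have hUe : ∀ᶠ n in (U : Filter ℕ), (e : EReal) < discreteValue d Ω r R f n :=
      le_principal_iff.1 ((Ultrafilter.of_le _).trans inf_le_right)
    have hXa : ∀ᶠ n in (U : Filter ℕ), Admissible d Ω r R n (X n) :=
      hUe.mono fun n hn => (hX n hn).1
    obtain ⟨P, ν, hP, hν⟩ := exists_tendsto_empirical hΩ_compact U hU
      (hXa.mono fun n hn => hn.mem)
    obtain ⟨ρ, hρ, hνρ⟩ := exists_density_of_tendsto hd hΩ_compact hΩ_fin hΩ_eucl hr hR hρp hρm
      h_pack h_cover hU hXa hP hν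
    have hE := tendsto_discreteEnergy hd hΩ_inf hΩ_fin hf hr hR hreg h_ratio hρm.le hρ hU hXa hP
      hν hνρ
    have hle : e ≤ densityEnergy d Ω f ρ :=
      ge_of_tendsto hE (hUe.mono fun n hn => (hX n hn).2.le)
    have hV : (densityEnergy d Ω f ρ : EReal) ≤ densityValue d Ω f ρp ρm :=
      le_iSup₂_of_le ρ hρ le_rfl
    exact hVe.not_ge ((EReal.coe_le_coe_iff.2 hle).trans hV)
  refine ⟨hlim, fun X' ρ hX' hρ hweak => ?_⟩
  have hV : densityValue d Ω f ρp ρm = densityEnergy d Ω f ρ :=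
    le_antisymm (iSup₂_le fun σ hσ => EReal.coe_le_coe_iff.2 (hρ.2 σ hσ))
      (le_iSup₂_of_le ρ hρ.1 le_rfl)
  obtain ⟨P, hP⟩ : ∃ P : ℕ → ProbabilityMeasure (Space p),
      ∀ n, 1 ≤ n → (P n : Measure (Space p)) = empirical n (X' n) := by
    classical
    refine ⟨fun n => if hn : 1 ≤ n then ⟨empirical n (X' n), isProbabilityMeasure_empirical hn _⟩
      else ⟨Measure.dirac 0, inferInstance⟩, fun n hn => by simp [hn]⟩
  have hP' : ∀ᶠ n in atTop, (P n : Measure (Space p)) = empirical n (X' n) :=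
    (eventually_ge_atTop 1).mono hP
  have hprob : IsProbabilityMeasure
      ((surface d Ω).withDensity fun x => ENNReal.ofReal (ρ x)) := by
    have := isFiniteMeasure_surface hΩ_fin
    refine ⟨?_⟩
    rw [withDensity_apply _ MeasurableSet.univ, setLIntegral_univ,
      ← ofReal_integral_eq_lintegral_ofReal (hρ.1.1.integrable le_top)
        (hρ.1.2.2.mono fun x hx => hρm.le.trans hx.1), hρ.1.2.1, ENNReal.ofReal_one]
  have hν : Tendsto P atTop (𝓝 ⟨_, hprob⟩) := by
    refine ProbabilityMeasure.tendsto_iff_forall_integral_tendsto.2 fun φ => ?_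
    refine (hweak φ φ.continuous.continuousOn).congr' ?_
    filter_upwards [hP'] with n hn
    rw [hn]
  have hE := tendsto_discreteEnergy hd hΩ_inf hΩ_fin hf hr hR hreg h_ratio hρm.le hρ.1 le_rfl hX'
    hP' hν rfl
  -- The energies of `X'` bound the discrete values from below and converge to the extremal energy.
  refine tendsto_of_le_liminf_of_limsup_le ?_ hlim
  have hE' : Tendsto (fun n => (discreteEnergy f n (X' n) : EReal)) atTop
      (𝓝 (densityValue d Ω f ρp ρm)) := by
    rw [hV]
    exact (continuous_coe_real_ereal.tendsto _).comp hE
  rw [← hE'.liminf_eq]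
  refine liminf_le_liminf ?_
  filter_upwards [hX'] with n hn
  exact le_iSup₂_of_le (X' n) hn le_rfl
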